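/- Let $m\ge 1$, $0<\lambda<1$, and let $\Omega\subset\mathbb{R}^m$ be bounded and open with $C^{2,\lambda}$ boundary (near each boundary point, $\Omega$ is, after a rigid motion, the region above the graph of a $C^{2,\lambda}$ function). Let $\tilde g\in C^{2,\lambda}(\overline\Omega)$ and $\hat f\in C^{0,\lambda}(\overline\Omega)$. Then the Dirichlet problem for Poisson's equation $$-\Delta u=\hat f\ \text{ in }\Omega,\qquad u=\tilde g\ \text{ on }\partial\Omega$$ has a unique solution $\hat u\in H^1(\Omega)$, where a solution is a function $u\in H^1(\Omega)$ with $u-\tilde g\in H^1_0(\Omega)$ and $\int_\Omega\nabla u\cdot\nabla v\,dx=\int_\Omega \hat f\,v\,dx$ for all $v\in H^1_0(\Omega)$, and uniqueness is up to equality almost everywhere. Call a function $d\in C^2(\overline\Omega)$ a boundary factor if $d=0$ on $\partial\Omega$ and $d\ne 0$ at every point of $\Omega$, and consider the ansatz functions $$u(x)=d(x)\,u_{NN}(x)+\tilde g(x),$$ where $d$ is a boundary factor and $u_{NN}=T^{(L)}\circ\tanh\circ T^{(L-1)}\circ\cdots\circ\tanh\circ T^{(1)}:\mathbb{R}^m\to\mathbb{R}$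 is a feedforward neural network with affine maps $T^{(i)}$, $\tanh$ acting componentwise, and any depth $L\ge1$ and layer widths. Boundary factors exist, and every ansatz function belongs to $H^1(\Omega)$. Moreover, for every $2\le p\le\infty$ and every $\epsilon>0$ there is $\delta>0$ such that every ansatz function $u$ (with any boundary factor and any network) satisfies $$\hat L_p(u)<\delta\ \Longrightarrow\ \|u-\hat u\|_{H^1(\Omega)}<\epsilon .$$ Here $\hat L_p(u)=\frac1{|\Omega|}\int_\Omega|-\Delta u-\hat f|^p\,dx$ for $p<\infty$, $\hat L_\infty(u)=\operatorname{ess\,sup}_\Omega|-\Delta u-\hat f|$, and $\|w\|_{H^1(\Omega)}^2=\int_\Omega (|w|^2+|\nabla w|^2)\,dx$. -/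

import Mathlib

open MeasureTheory Set
open scoped ContDiff

noncomputable section

namespace PoissonNN

/-! ### Classical function spaces and domains -/

/-- `u ∈ C^k(closure U)` for an open set `U`: `u` is continuous on the closure, of class `C^k` in
`U`, and all its derivatives of order at most `k` extend continuously to the closure.
Only the values of `u` on the closure of `U` matter. -/
structure MemCk {F : Type*} [NormedAddCommGroup F] [NormedSpace ℝ F]
    (k : ℕ) (U : Set F) (u : F → ℝ) : Prop where
  continuousOn : ContinuousOn u (closure U)
  contDiffOn : ContDiffOn ℝ k u U
  extend : ∀ i : ℕ, i ≤ k → ∃ G : F → ContinuousMultilinearMap ℝ (fun _ : Fin i => F) ℝ,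
    ContinuousOn G (closure U) ∧ EqOn (iteratedFDeriv ℝ i u) G U

/-- `u ∈ C^{k,lam}(closure U)`: moreover the derivatives of order `k` are uniformly Hölder
continuous with exponent `lam` in `U`. -/
structure MemHolder {F : Type*} [NormedAddCommGroup F] [NormedSpace ℝ F]
    (k : ℕ) (lam : NNReal) (U : Set F) (u : F → ℝ) : Prop where
  memCk : MemCk k U u
  holder : ∃ C : NNReal, HolderOnWith C lam (iteratedFDeriv ℝ k u) U

/-- The open set `Ω` has a boundary of class `C^{k,lam}`: near each boundary point `x₀` and for a
suitable unit vector `ν`, the set `Ω` is the region above the graph of a `C^{k,lam}` function `γ`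
defined on the hyperplane orthogonal to `ν`, the height being measured along `ν`. -/
def HasHolderBoundary {E : Type*} [NormedAddCommGroup E] [InnerProductSpace ℝ E]
    [FiniteDimensional ℝ E] (k : ℕ) (lam : NNReal) (Ω : Set E) : Prop :=
  ∀ x₀ ∈ frontier Ω, ∃ (ν : E) (r : ℝ) (γ : (Submodule.span ℝ {ν})ᗮ → ℝ),
    ‖ν‖ = 1 ∧ 0 < r ∧
    MemHolder k lam (Metric.ball ((Submodule.span ℝ {ν})ᗮ.orthogonalProjectionOnto x₀) r) γ ∧
    ∀ x ∈ Metric.ball x₀ r,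
      (x ∈ Ω ↔ γ ((Submodule.span ℝ {ν})ᗮ.orthogonalProjectionOnto x) < inner ℝ ν x)

/-! ### The Sobolev spaces `H¹` and `H¹₀` -/

section Sobolev

variable {E : Type*} [NormedAddCommGroup E] [InnerProductSpace ℝ E] [FiniteDimensional ℝ E]
  [MeasurableSpace E] [BorelSpace E]

/-- Test functions: `φ ∈ C_c^∞(Ω)`. -/
structure IsTestFunction (Ω : Set E) (φ : E → ℝ) : Prop where
  contDiff : ContDiff ℝ ∞ φ
  hasCompactSupport : HasCompactSupport φ
  tsupport_subset : tsupport φ ⊆ Ω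

/-- `G` is a weak gradient of `u` in `Ω` that belongs to `L²(Ω)`. -/
structure IsWeakGradient (Ω : Set E) (u : E → ℝ) (G : E → E) : Prop where
  memLp : MemLp G 2 (volume.restrict Ω)
  integral_eq : ∀ φ : E → ℝ, IsTestFunction Ω φ → ∀ v : E,
    ∫ x in Ω, u x * fderiv ℝ φ x v = - ∫ x in Ω, inner ℝ (G x) v * φ x

/-- `u ∈ H¹(Ω)`: `u` is in `L²(Ω)` and has a weak gradient in `L²(Ω)`. -/
structure MemH1 (Ω : Set E) (u : E → ℝ) : Prop where
  memLp : MemLp u 2 (volume.restrict Ω)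
  exists_weakGradient : ∃ G : E → E, IsWeakGradient Ω u G

open Classical in
/-- The weak gradient of `u` in `Ω` (unique almost everywhere in `Ω` for `u ∈ H¹(Ω)`; the value
is `0` if there is none in `L²(Ω)`). -/
def weakGrad (Ω : Set E) (u : E → ℝ) : E → E :=
  if h : ∃ G : E → E, IsWeakGradient Ω u G then h.choose else 0

/-- The norm of `H¹(Ω)`. -/
def h1Norm (Ω : Set E) (u : E → ℝ) : ℝ :=
  Real.sqrt ((∫ x in Ω, u x ^ 2) + ∫ x in Ω, ‖weakGrad Ω u x‖ ^ 2)

/-- `u ∈ H¹₀(Ω)`, the closure of `C_c^∞(Ω)` in `H¹(Ω)`. -/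
structure MemH10 (Ω : Set E) (u : E → ℝ) : Prop where
  memH1 : MemH1 Ω u
  approx : ∀ ε : ℝ, 0 < ε → ∃ φ : E → ℝ, IsTestFunction Ω φ ∧ h1Norm Ω (u - φ) < ε

/-! ### The Dirichlet problem and the generalized loss -/

/-- `u ∈ H¹(Ω)` solves `-Δ u = f` in `Ω`, `u = g` on the boundary of `Ω`, in the weak sense; the
boundary condition reads `u - g ∈ H¹₀(Ω)`. -/
structure IsPoissonSolution (Ω : Set E) (f g : E → ℝ) (u : E → ℝ) : Prop where
  memH1 : MemH1 Ω u
  boundary : MemH10 Ω (u - g)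
  equation : ∀ v : E → ℝ, MemH10 Ω v →
    ∫ x in Ω, inner ℝ (weakGrad Ω u x) (weakGrad Ω v x) = ∫ x in Ω, f x * v x

/-- The residual `-Δ u(x) - f(x)` of the Poisson equation in strong form. -/
def poissonResidual (f u : E → ℝ) (x : E) : ℝ :=
  -(Laplacian.laplacian u x) - f x

open Classical in
/-- The generalized loss: `|Ω|⁻¹ ∫_Ω |-Δ u - f|^p` if `p < ∞`, and the essential supremum of
`|-Δ u - f|` over `Ω` if `p = ∞`. -/
def generalizedLoss (Ω : Set E) (f : E → ℝ) (p : ENNReal) (u : E → ℝ) : ENNReal :=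
  if p = ⊤ then eLpNorm (poissonResidual f u) ⊤ (volume.restrict Ω)
  else (volume Ω)⁻¹ * ∫⁻ x in Ω, ‖poissonResidual f u x‖ₑ ^ p.toReal

end Sobolev

/-! ### The neural network ansatz -/

/-- The parameters of a feedforward neural network with `n` inputs, `o` outputs, and any number of
hidden layers of any widths: a nonempty chain of affine maps `y ↦ W y + b`. -/
inductive Network : ℕ → ℕ → Type
  | last {n o : ℕ} (W : Matrix (Fin o) (Fin n) ℝ) (b : Fin o → ℝ) : Network n o
  | layer {n k o : ℕ} (W : Matrix (Fin k) (Fin n) ℝ) (b : Fin k → ℝ)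
      (rest : Network k o) : Network n o

/-- The function computed by a network; the activation function `tanh` is applied componentwise
after every affine map except the last one. -/
def Network.eval : {n o : ℕ} → Network n o → (Fin n → ℝ) → (Fin o → ℝ)
  | _, _, .last W b, x => W.mulVec x + b
  | _, _, .layer W b rest, x => rest.eval (fun j => Real.tanh ((W.mulVec x + b) j))

/-- `d ∈ C²(closure Ω)` vanishes on the boundary of `Ω` and has no zero in `Ω`. -/
structure IsBoundaryFactor {m : ℕ} (Ω : Set (EuclideanSpace ℝ (Fin m)))
    (d : EuclideanSpace ℝ (Fin m) → ℝ) : Prop where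
  memCk : MemCk 2 Ω d
  eq_zero : ∀ x ∈ frontier Ω, d x = 0
  ne_zero : ∀ x ∈ Ω, d x ≠ 0

/-- The ansatz `u(x) = d(x) * u_NN(x) + g(x)`. -/
def ansatz {m : ℕ} (d : EuclideanSpace ℝ (Fin m) → ℝ) (N : Network m 1)
    (g : EuclideanSpace ℝ (Fin m) → ℝ) (x : EuclideanSpace ℝ (Fin m)) : ℝ :=
  d x * N.eval (fun i => x i) 0 + g x

end PoissonNN

end

set_option linter.unusedSectionVars false

noncomputable section

namespace PoissonNN

section Sobolev

variable {E : Type*} [NormedAddCommGroup E] [InnerProductSpace ℝ E] [FiniteDimensional ℝ E]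
  [MeasurableSpace E] [BorelSpace E]

/-! ### Integration by parts against compactly supported functions -/

/-! The estimate is an energy estimate. Let `r = -Δu - f` be the residual of an ansatz function `u`.
Then `w = u - uhat` lies in `H¹₀` and satisfies `∫ ∇w·∇v = ∫ r v` for every `v` in `H¹₀`. Testing
with `v = w` and using Poincaré's inequality gives `‖w‖ ≤ (4R² + 1) ‖r‖` with the `H¹` norm on the
left and the `L²` norm on the right, where `R` bounds `|x|` on `Ω` (`norm_le_of_mem_h10Pairs`,
`IsPoissonSolution.h1Norm_sub_le`). The constant depends on neither `d` nor the network. Since `Ω`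
has finite measure and `p ≥ 2`, Hölder's inequality bounds the `L²` norm of `r` by its `L^p` norm,
hence by the loss.

Existence follows from Lax–Milgram on `H¹₀`, and uniqueness from the same estimate with `r = 0`. To
have Hilbert spaces at hand, functions are replaced by pairs `(u, ∇u)` in `L² × L²`: there `H¹` is
an orthogonal complement and `H¹₀` is the closure of the test pairs.

The remaining point is that `d * u_NN` belongs to `H¹₀` (`memH10_mul`), which is proved without
traces. Cutting off where `|d|` is small leaves a compactly supported `C¹` function, which
mollification puts in `H¹₀`. The error tends to zero in `H¹` because the large derivative of the
cutoff is compensated by the factor `d`. -/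

theorem continuous_mul_of_tsupport_subset {Ω : Set E} (hΩ : IsOpen Ω) {k ψ : E → ℝ}
    (hk : ContinuousOn k Ω) (hψ : Continuous ψ) (hs : tsupport ψ ⊆ Ω) :
    Continuous fun x => k x * ψ x :=
  continuous_of_tsupport fun _ hx =>
    (hk.continuousAt (hΩ.mem_nhds (hs (tsupport_mul_subset_right hx)))).mul hψ.continuousAt

theorem integrable_mul_of_tsupport_subset {Ω : Set E} (hΩ : IsOpen Ω) {k ψ : E → ℝ}
    (hk : ContinuousOn k Ω) (hψ : Continuous ψ) (hc : HasCompactSupport ψ) (hs : tsupport ψ ⊆ Ω) :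
    Integrable (fun x => k x * ψ x) :=
  (continuous_mul_of_tsupport_subset hΩ hk hψ hs).integrable_of_hasCompactSupport hc.mul_left

theorem tsupport_fderiv_apply_subset (φ : E → ℝ) (v : E) :
    tsupport (fun x => fderiv ℝ φ x v) ⊆ tsupport φ := by
  refine subset_trans (closure_mono fun x hx => ?_) (tsupport_fderiv_subset ℝ (f := φ))
  rw [Function.mem_support] at hx ⊢
  exact fun h => hx (by simp [h])

/-- Since `φ` is supported in a compact subset of `Ω`, both integrals extend by zero to the whole
space, so no boundary term appears, and the values of `h` outside `Ω` play no role. -/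
theorem setIntegral_mul_fderiv_eq_neg {Ω : Set E} (hΩ : IsOpen Ω) {h φ : E → ℝ}
    (hh : ContDiffOn ℝ 1 h Ω) (hφ : ContDiff ℝ 1 φ) (hc : HasCompactSupport φ)
    (hs : tsupport φ ⊆ Ω) (v : E) :
    ∫ x in Ω, h x * fderiv ℝ φ x v = -∫ x in Ω, fderiv ℝ h x v * φ x := by
  have hz : ∀ x, x ∉ Ω → φ x = 0 := fun x hx => image_eq_zero_of_notMem_tsupport fun h => hx (hs h)
  have hz' : ∀ x, x ∉ Ω → fderiv ℝ φ x v = 0 := fun x hx =>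
    image_eq_zero_of_notMem_tsupport (f := fun x => fderiv ℝ φ x v)
      fun h => hx (hs (tsupport_fderiv_apply_subset φ v h))
  rw [setIntegral_eq_integral_of_forall_compl_eq_zero fun x hx => by simp [hz' x hx],
    setIntegral_eq_integral_of_forall_compl_eq_zero fun x hx => by simp [hz x hx]]
  have hdφ : Continuous fun x => fderiv ℝ φ x v :=
    (hφ.continuous_fderiv one_ne_zero).clm_apply continuous_const
  have hdh : ContinuousOn (fun x => fderiv ℝ h x v) Ω :=
    (hh.continuousOn_fderiv_of_isOpen hΩ le_rfl).clm_apply continuousOn_const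
  exact integral_mul_fderiv_eq_neg_fderiv_mul_of_integrable
    (integrable_mul_of_tsupport_subset hΩ hdh hφ.continuous hc hs)
    (integrable_mul_of_tsupport_subset hΩ hh.continuousOn hdφ
      (hc.fderiv_apply ℝ v) ((tsupport_fderiv_apply_subset φ v).trans hs))
    (integrable_mul_of_tsupport_subset hΩ hh.continuousOn hφ.continuous hc hs)
    (fun x hx => (hh.differentiableOn one_ne_zero).differentiableAt (hΩ.mem_nhds (hs hx)))
    (fun x _ => (hφ.differentiable one_ne_zero).differentiableAt)

theorem continuous_gradient {φ : E → ℝ} (hφ : ContDiff ℝ 1 φ) :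
    Continuous (gradient φ) :=
  (InnerProductSpace.toDual ℝ E).symm.continuous.comp (hφ.continuous_fderiv one_ne_zero)

theorem hasCompactSupport_gradient {φ : E → ℝ} (hc : HasCompactSupport φ) :
    HasCompactSupport (gradient φ) :=
  (hc.fderiv ℝ).comp_left (map_zero (InnerProductSpace.toDual ℝ E).symm)

theorem memLp_gradient {Ω : Set E} {φ : E → ℝ} (hφ : ContDiff ℝ 1 φ)
    (hc : HasCompactSupport φ) : MemLp (gradient φ) 2 (volume.restrict Ω) :=
  ((continuous_gradient hφ).memLp_of_hasCompactSupport
    (hasCompactSupport_gradient hc)).restrict Ω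

theorem isWeakGradient_gradient {Ω : Set E} (hΩ : IsOpen Ω) {u : E → ℝ}
    (hu : ContDiffOn ℝ 1 u Ω) (hG : MemLp (gradient u) 2 (volume.restrict Ω)) :
    IsWeakGradient Ω u (gradient u) where
  memLp := hG
  integral_eq φ hφ v := by
    simpa using setIntegral_mul_fderiv_eq_neg hΩ hu (hφ.contDiff.of_le (by simp))
      hφ.hasCompactSupport hφ.tsupport_subset v

namespace IsTestFunction

variable {Ω : Set E} {φ ψ : E → ℝ}

theorem contDiff_one (hφ : IsTestFunction Ω φ) : ContDiff ℝ 1 φ := hφ.contDiff.of_le (by simp)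

theorem differentiable (hφ : IsTestFunction Ω φ) : Differentiable ℝ φ :=
  hφ.contDiff_one.differentiable one_ne_zero

theorem memLp (hφ : IsTestFunction Ω φ) : MemLp φ 2 (volume.restrict Ω) :=
  (hφ.contDiff.continuous.memLp_of_hasCompactSupport hφ.hasCompactSupport).restrict Ω

theorem memLp_fderiv_apply (hφ : IsTestFunction Ω φ) (v : E) :
    MemLp (fun x => fderiv ℝ φ x v) 2 (volume.restrict Ω) :=
  (((hφ.contDiff_one.continuous_fderiv one_ne_zero).clm_apply
    continuous_const).memLp_of_hasCompactSupport
      (hφ.hasCompactSupport.fderiv_apply ℝ v)).restrict Ω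

theorem memLp_smul (hφ : IsTestFunction Ω φ) (v : E) :
    MemLp (fun x => φ x • v) 2 (volume.restrict Ω) :=
  ((hφ.contDiff.continuous.smul continuous_const).memLp_of_hasCompactSupport
    hφ.hasCompactSupport.smul_right).restrict Ω

theorem memLp_gradient (hφ : IsTestFunction Ω φ) : MemLp (gradient φ) 2 (volume.restrict Ω) :=
  PoissonNN.memLp_gradient hφ.contDiff_one hφ.hasCompactSupport

theorem zero (Ω : Set E) : IsTestFunction Ω (0 : E → ℝ) :=
  ⟨contDiff_const, HasCompactSupport.zero, by simp⟩

theorem add (hφ : IsTestFunction Ω φ) (hψ : IsTestFunction Ω ψ) : IsTestFunction Ω (φ + ψ) :=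
  ⟨hφ.contDiff.add hψ.contDiff, hφ.hasCompactSupport.add hψ.hasCompactSupport,
    (tsupport_add φ ψ).trans (union_subset hφ.tsupport_subset hψ.tsupport_subset)⟩

theorem const_smul (hφ : IsTestFunction Ω φ) (c : ℝ) : IsTestFunction Ω (c • φ) :=
  ⟨hφ.contDiff.const_smul c, hφ.hasCompactSupport.smul_left (f := fun _ => c),
    (tsupport_smul_subset_right (fun _ => c) φ).trans hφ.tsupport_subset⟩

end IsTestFunction

/-! ### `H¹` as a closed subspace of a product of `L²` spaces -/

/-- The Hilbert space `L²(Ω) × L²(Ω; E)`, in which `u ∈ H¹(Ω)` is represented by the pair of `u`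
and its weak gradient. -/
abbrev L2Pair (Ω : Set E) : Type _ :=
  WithLp 2 (Lp ℝ 2 (volume.restrict Ω) × Lp E 2 (volume.restrict Ω))

/-- The pair of square integrable functions `(u, G)`. -/
def toPair {Ω : Set E} {u : E → ℝ} {G : E → E} (hu : MemLp u 2 (volume.restrict Ω))
    (hG : MemLp G 2 (volume.restrict Ω)) : L2Pair Ω :=
  WithLp.toLp 2 (hu.toLp u, hG.toLp G)

section toPair

variable {Ω : Set E} {u : E → ℝ} {G : E → E} (hu : MemLp u 2 (volume.restrict Ω))
  (hG : MemLp G 2 (volume.restrict Ω))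

theorem toPair_fst : (toPair hu hG).fst =ᵐ[volume.restrict Ω] u := hu.coeFn_toLp

theorem toPair_snd : (toPair hu hG).snd =ᵐ[volume.restrict Ω] G := hG.coeFn_toLp

theorem inner_toPair (a : L2Pair Ω) :
    inner ℝ (toPair hu hG) a =
      (∫ x in Ω, a.fst x * u x) + ∫ x in Ω, inner ℝ (a.snd x) (G x) := by
  rw [WithLp.prod_inner_apply, L2.inner_def, L2.inner_def]
  congr 1
  · refine integral_congr_ae ?_
    filter_upwards [toPair_fst hu hG] with x hx
    rw [show ((toPair hu hG).ofLp.1 : E → ℝ) x = u x from hx]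
    rfl
  · refine integral_congr_ae ?_
    filter_upwards [toPair_snd hu hG] with x hx
    rw [show ((toPair hu hG).ofLp.2 : E → E) x = G x from hx, real_inner_comm]
    rfl

end toPair

theorem norm_sq_L2_eq {F : Type*} [NormedAddCommGroup F] [InnerProductSpace ℝ F] {Ω : Set E}
    (f : Lp F 2 (volume.restrict Ω)) : ‖f‖ ^ 2 = ∫ x in Ω, ‖f x‖ ^ 2 := by
  rw [← real_inner_self_eq_norm_sq, L2.inner_def]
  simp

/-- The pairs `(u, G)` such that `G` is a weak gradient of `u`. -/
def weakPairs (Ω : Set E) : Submodule ℝ (L2Pair Ω) :=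
  (Submodule.span ℝ {b | ∃ (φ : E → ℝ) (hφ : IsTestFunction Ω φ) (v : E),
    b = toPair (hφ.memLp_fderiv_apply v) (hφ.memLp_smul v)})ᗮ

/-- Orthogonality to `(∂ᵥφ, φ v)` is exactly the integration by parts identity that defines a weak
gradient. Hence limits of weakly differentiable pairs are again such pairs. -/
theorem mem_weakPairs {Ω : Set E} {a : L2Pair Ω} :
    a ∈ weakPairs Ω ↔ IsWeakGradient Ω a.fst a.snd := by
  have key : a ∈ weakPairs Ω ↔ ∀ φ : E → ℝ, IsTestFunction Ω φ → ∀ v : E,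
      (∫ x in Ω, a.fst x * fderiv ℝ φ x v) + ∫ x in Ω, inner ℝ (a.snd x) v * φ x = 0 := by
    rw [weakPairs, Submodule.mem_orthogonal]
    constructor
    · intro h φ hφ v
      have := h _ (Submodule.subset_span ⟨φ, hφ, v, rfl⟩)
      rw [inner_toPair] at this
      simpa [inner_smul_right, mul_comm] using this
    · intro h b hb
      induction hb using Submodule.span_induction with
      | mem b hb =>
        obtain ⟨φ, hφ, v, rfl⟩ := hb
        rw [inner_toPair]
        simpa [inner_smul_right, mul_comm] using h φ hφ v
      | zero => simp
      | add b c _ _ hb hc => rw [inner_add_left, hb, hc, add_zero]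
      | smul r b _ hb => rw [inner_smul_left, hb, mul_zero]
  rw [key]
  exact ⟨fun h => ⟨Lp.memLp _, fun φ hφ v => eq_neg_of_add_eq_zero_left (h φ hφ v)⟩,
    fun h φ hφ v => by rw [h.integral_eq φ hφ v, neg_add_cancel]⟩

theorem isClosed_weakPairs (Ω : Set E) : IsClosed (weakPairs Ω : Set (L2Pair Ω)) :=
  Submodule.isClosed_orthogonal _

theorem IsWeakGradient.congr {Ω : Set E} {u u' : E → ℝ} {G G' : E → E}
    (h : IsWeakGradient Ω u G) (hu : u =ᵐ[volume.restrict Ω] u')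
    (hG : G =ᵐ[volume.restrict Ω] G') : IsWeakGradient Ω u' G' where
  memLp := h.memLp.ae_eq hG
  integral_eq φ hφ v := by
    have h1 : ∫ x in Ω, u' x * fderiv ℝ φ x v = ∫ x in Ω, u x * fderiv ℝ φ x v :=
      integral_congr_ae (by filter_upwards [hu] with x hx; rw [hx])
    have h2 : ∫ x in Ω, inner ℝ (G' x) v * φ x = ∫ x in Ω, inner ℝ (G x) v * φ x :=
      integral_congr_ae (by filter_upwards [hG] with x hx; rw [hx])
    rw [h1, h2, h.integral_eq φ hφ v]

/-- The weak gradient is determined almost everywhere by the function. -/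
theorem IsWeakGradient.ae_eq {Ω : Set E} (hΩ : IsOpen Ω) {u : E → ℝ} {G G' : E → E}
    (h : IsWeakGradient Ω u G) (h' : IsWeakGradient Ω u G') : G =ᵐ[volume.restrict Ω] G' := by
  have hm : MemLp (G - G') 2 (volume.restrict Ω) := h.memLp.sub h'.memLp
  have hloc : LocallyIntegrableOn (G - G') Ω volume :=
    (locallyIntegrableOn_of_locallyIntegrable_restrict
      (hm.locallyIntegrable (by norm_num)))
  -- Fundamental lemma of the calculus of variations; the vector-valued integral is shown to vanish
  -- by pairing it with every constant vector `v`.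
  have key := hΩ.ae_eq_zero_of_integral_contDiff_smul_eq_zero hloc fun φ h1 h2 h3 => by
    have hφ : IsTestFunction Ω φ := ⟨h1, h2, h3⟩
    have hint : ∀ {K : E → E}, MemLp K 2 (volume.restrict Ω) →
        Integrable (fun x => φ x • K x) (volume.restrict Ω) := fun hK =>
      memLp_one_iff_integrable.1 (hK.smul (r := 1) hφ.memLp)
    rw [← setIntegral_eq_integral_of_forall_compl_eq_zero (s := Ω) fun x hx => by
      rw [image_eq_zero_of_notMem_tsupport fun h => hx (h3 h), zero_smul]]
    refine integral_eq_zero_of_forall_integral_inner_eq_zero ℝ _ (hint hm) fun v => ?_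
    have h4 := h.integral_eq φ hφ v
    rw [h'.integral_eq φ hφ v, neg_inj] at h4
    have h5 : ∀ {K : E → E}, MemLp K 2 (volume.restrict Ω) →
        Integrable (fun x => inner ℝ (K x) v * φ x) (volume.restrict Ω) := fun hK => by
      refine ((hint hK).inner_const v).congr (.of_forall fun x => ?_)
      simp [inner_smul_left, mul_comm]
    calc ∫ x in Ω, inner ℝ v (φ x • (G - G') x)
        = ∫ x in Ω, (inner ℝ (G x) v * φ x - inner ℝ (G' x) v * φ x) := by
          congr with x
          simp [inner_smul_right, inner_sub_right, real_inner_comm v]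
          ring
      _ = 0 := by rw [integral_sub (h5 h.memLp) (h5 h'.memLp), h4, sub_self]
  filter_upwards [(ae_restrict_iff' hΩ.measurableSet).2 key] with x hx
  exact sub_eq_zero.1 hx

/-- The pair `a` consists of `u` and its weak gradient. -/
structure IsH1Pair {Ω : Set E} (a : L2Pair Ω) (u : E → ℝ) : Prop where
  mem : a ∈ weakPairs Ω
  ae_eq : a.fst =ᵐ[volume.restrict Ω] u

namespace IsH1Pair

variable {Ω : Set E} {a b : L2Pair Ω} {u w : E → ℝ}

theorem isWeakGradient (h : IsH1Pair a u) : IsWeakGradient Ω u a.snd :=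
  (mem_weakPairs.1 h.mem).congr h.ae_eq .rfl

theorem memH1 (h : IsH1Pair a u) : MemH1 Ω u :=
  ⟨(Lp.memLp a.fst).ae_eq h.ae_eq, a.snd, h.isWeakGradient⟩

theorem sub (ha : IsH1Pair a u) (hb : IsH1Pair b w) : IsH1Pair (a - b) (u - w) :=
  ⟨sub_mem ha.mem hb.mem, (Lp.coeFn_sub a.fst b.fst).trans (ha.ae_eq.sub hb.ae_eq)⟩

theorem add (ha : IsH1Pair a u) (hb : IsH1Pair b w) : IsH1Pair (a + b) (u + w) :=
  ⟨add_mem ha.mem hb.mem, (Lp.coeFn_add a.fst b.fst).trans (ha.ae_eq.add hb.ae_eq)⟩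

theorem congr (h : IsH1Pair a u) (huw : u =ᵐ[volume.restrict Ω] w) : IsH1Pair a w :=
  ⟨h.mem, h.ae_eq.trans huw⟩

theorem weakGrad_ae_eq (hΩ : IsOpen Ω) (h : IsH1Pair a u) :
    weakGrad Ω u =ᵐ[volume.restrict Ω] a.snd := by
  have hex : ∃ G, IsWeakGradient Ω u G := ⟨_, h.isWeakGradient⟩
  rw [weakGrad, dif_pos hex]
  exact hex.choose_spec.ae_eq hΩ h.isWeakGradient

/-- Uniqueness of weak gradients makes the choice hidden in `weakGrad` harmless, so the `H¹` norm
becomes a Hilbert space norm. -/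
theorem h1Norm_eq (hΩ : IsOpen Ω) (h : IsH1Pair a u) : h1Norm Ω u = ‖a‖ := by
  have h1 : ∫ x in Ω, u x ^ 2 = ‖a.fst‖ ^ 2 := by
    rw [norm_sq_L2_eq]
    refine integral_congr_ae ?_
    filter_upwards [h.ae_eq] with x hx
    rw [hx, Real.norm_eq_abs, sq_abs]
  have h2 : ∫ x in Ω, ‖weakGrad Ω u x‖ ^ 2 = ‖a.snd‖ ^ 2 := by
    rw [norm_sq_L2_eq]
    refine integral_congr_ae ?_
    filter_upwards [h.weakGrad_ae_eq hΩ] with x hx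
    rw [hx]
  rw [h1Norm, h1, h2, ← WithLp.prod_norm_sq_eq_of_L2, Real.sqrt_sq (norm_nonneg _)]

end IsH1Pair

theorem isH1Pair_toPair {Ω : Set E} {u : E → ℝ} {G : E → E}
    (hu : MemLp u 2 (volume.restrict Ω)) (hG : IsWeakGradient Ω u G) :
    IsH1Pair (toPair hu hG.memLp) u :=
  ⟨mem_weakPairs.2 (hG.congr (toPair_fst hu hG.memLp).symm (toPair_snd hu hG.memLp).symm),
    toPair_fst hu hG.memLp⟩

theorem MemH1.exists_isH1Pair {Ω : Set E} {u : E → ℝ} (h : MemH1 Ω u) :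
    ∃ a : L2Pair Ω, IsH1Pair a u :=
  let ⟨_, hG⟩ := h.exists_weakGradient
  ⟨_, isH1Pair_toPair h.memLp hG⟩

/-! ### `H¹₀` as a closed subspace -/

theorem gradient_add' {φ ψ : E → ℝ} (hφ : Differentiable ℝ φ) (hψ : Differentiable ℝ ψ) :
    gradient (φ + ψ) = gradient φ + gradient ψ := by
  ext1 x
  simp [gradient, fderiv_add (hφ x) (hψ x)]

theorem gradient_const_smul' {φ : E → ℝ} (hφ : Differentiable ℝ φ) (c : ℝ) :
    gradient (c • φ) = c • gradient φ := by
  ext1 x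
  simp [gradient, fderiv_const_smul (hφ x) c]

/-- The pairs `(φ, ∇φ)` of test functions. -/
def testPairs (Ω : Set E) : Submodule ℝ (L2Pair Ω) where
  carrier := {a | ∃ φ, IsTestFunction Ω φ ∧ a.fst =ᵐ[volume.restrict Ω] φ ∧
    a.snd =ᵐ[volume.restrict Ω] gradient φ}
  zero_mem' := ⟨0, .zero Ω, Lp.coeFn_zero _ _ _, (Lp.coeFn_zero _ _ _).trans
    (.of_forall fun x => (gradient_fun_const (𝕜 := ℝ) x (0 : ℝ)).symm)⟩
  add_mem' := by
    rintro a b ⟨φ, hφ, h1, h2⟩ ⟨ψ, hψ, h3, h4⟩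
    refine ⟨φ + ψ, hφ.add hψ, (Lp.coeFn_add a.fst b.fst).trans (h1.add h3), ?_⟩
    rw [gradient_add' hφ.differentiable hψ.differentiable]
    exact (Lp.coeFn_add a.snd b.snd).trans (h2.add h4)
  smul_mem' := by
    rintro c a ⟨φ, hφ, h1, h2⟩
    refine ⟨c • φ, hφ.const_smul c, (Lp.coeFn_smul c a.fst).trans (h1.const_smul c), ?_⟩
    rw [gradient_const_smul' hφ.differentiable]
    exact (Lp.coeFn_smul c a.snd).trans (h2.const_smul c)

theorem isH1Pair_test {Ω : Set E} (hΩ : IsOpen Ω) {φ : E → ℝ} (hφ : IsTestFunction Ω φ) :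
    IsH1Pair (toPair hφ.memLp hφ.memLp_gradient) φ :=
  isH1Pair_toPair hφ.memLp
    (isWeakGradient_gradient hΩ hφ.contDiff_one.contDiffOn hφ.memLp_gradient)

theorem testPairs_le_weakPairs {Ω : Set E} (hΩ : IsOpen Ω) : testPairs Ω ≤ weakPairs Ω := by
  rintro a ⟨φ, hφ, h1, h2⟩
  exact mem_weakPairs.2 ((isWeakGradient_gradient hΩ hφ.contDiff_one.contDiffOn
    hφ.memLp_gradient).congr h1.symm h2.symm)

/-- The closure of the pairs `(φ, ∇φ)` of test functions, a copy of `H¹₀(Ω)`. -/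
def h10Pairs (Ω : Set E) : Submodule ℝ (L2Pair Ω) := (testPairs Ω).topologicalClosure

theorem isClosed_h10Pairs (Ω : Set E) : IsClosed (h10Pairs Ω : Set (L2Pair Ω)) :=
  Submodule.isClosed_topologicalClosure _

instance (Ω : Set E) : CompleteSpace (h10Pairs Ω) :=
  (isClosed_h10Pairs Ω).completeSpace_coe

theorem h10Pairs_le_weakPairs {Ω : Set E} (hΩ : IsOpen Ω) : h10Pairs Ω ≤ weakPairs Ω :=
  Submodule.topologicalClosure_minimal _ (testPairs_le_weakPairs hΩ) (isClosed_weakPairs Ω)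

/-- A closed condition that holds for all test functions holds on `H¹₀`. -/
theorem h10Pairs_induction {Ω : Set E} {p : L2Pair Ω → Prop} (hp : IsClosed {a | p a})
    (h : ∀ φ (hφ : IsTestFunction Ω φ), p (toPair hφ.memLp hφ.memLp_gradient))
    {a : L2Pair Ω} (ha : a ∈ h10Pairs Ω) : p a := by
  refine closure_minimal (t := {a | p a}) ?_ hp ha
  rintro b ⟨φ, hφ, h1, h2⟩
  suffices b = toPair hφ.memLp hφ.memLp_gradient from this ▸ h φ hφ
  refine (WithLp.ofLp_injective 2) (Prod.ext ?_ ?_)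
  · exact Lp.ext (h1.trans (toPair_fst hφ.memLp hφ.memLp_gradient).symm)
  · exact Lp.ext (h2.trans (toPair_snd hφ.memLp hφ.memLp_gradient).symm)

theorem toPair_mem_testPairs {Ω : Set E} {φ : E → ℝ} (hφ : IsTestFunction Ω φ) :
    toPair hφ.memLp hφ.memLp_gradient ∈ testPairs Ω :=
  ⟨φ, hφ, toPair_fst _ _, toPair_snd _ _⟩

theorem IsH1Pair.memH10_iff {Ω : Set E} (hΩ : IsOpen Ω) {a : L2Pair Ω} {u : E → ℝ}
    (h : IsH1Pair a u) : MemH10 Ω u ↔ a ∈ h10Pairs Ω := by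
  have hdist : ∀ φ (hφ : IsTestFunction Ω φ), h1Norm Ω (u - φ) =
      dist a (toPair hφ.memLp hφ.memLp_gradient) := fun φ hφ => by
    rw [(h.sub (isH1Pair_test hΩ hφ)).h1Norm_eq hΩ, dist_eq_norm]
  constructor
  · intro hu
    refine Metric.mem_closure_iff.2 fun ε hε => ?_
    obtain ⟨φ, hφ, hlt⟩ := hu.approx ε hε
    exact ⟨_, toPair_mem_testPairs hφ, hdist φ hφ ▸ hlt⟩
  · intro ha
    refine ⟨h.memH1, fun ε hε => ?_⟩
    obtain ⟨b, ⟨φ, hφ, h1, h2⟩, hlt⟩ := Metric.mem_closure_iff.1 ha ε hε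
    refine ⟨φ, hφ, ?_⟩
    have hb : IsH1Pair b φ := ⟨testPairs_le_weakPairs hΩ ⟨φ, hφ, h1, h2⟩, h1⟩
    rwa [(h.sub hb).h1Norm_eq hΩ, ← dist_eq_norm]

theorem isH1Pair_of_mem_h10Pairs {Ω : Set E} (hΩ : IsOpen Ω) {a : L2Pair Ω}
    (ha : a ∈ h10Pairs Ω) : IsH1Pair a a.fst :=
  ⟨h10Pairs_le_weakPairs hΩ ha, .rfl⟩

/-! ### Poincaré's inequality -/

/-- For a unit vector `e`, integrating the divergence of `⟨e, x⟩ φ² e` gives `∫ φ² = -2 ∫ ⟨e, x⟩ φ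
∂ₑφ`. As `|⟨e, x⟩| ≤ R`, Young's inequality absorbs half of `∫ φ²` into the left side. -/
theorem IsTestFunction.poincare [Nontrivial E] {Ω : Set E} (hΩ : IsOpen Ω) {R : ℝ}
    (hR : ∀ x ∈ Ω, ‖x‖ ≤ R) {φ : E → ℝ} (hφ : IsTestFunction Ω φ) :
    ∫ x in Ω, φ x ^ 2 ≤ 4 * R ^ 2 * ∫ x in Ω, ‖gradient φ x‖ ^ 2 := by
  obtain ⟨e, he⟩ := exists_norm_eq E zero_le_one
  have hsq : Integrable (fun x => φ x ^ 2) (volume.restrict Ω) := hφ.memLp.integrable_sq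
  have hgr : Integrable (fun x => ‖gradient φ x‖ ^ 2) (volume.restrict Ω) :=
    hφ.memLp_gradient.norm.integrable_sq
  have hie : ContDiff ℝ 1 fun x : E => inner ℝ e x := contDiff_const.inner ℝ contDiff_id
  have hde : ∀ x, fderiv ℝ (fun x : E => inner ℝ e x * φ x) x e
      = inner ℝ e x * fderiv ℝ φ x e + φ x := fun x => by
    have h1 : HasFDerivAt (fun x : E => inner ℝ e x) (innerSL ℝ e) x := (innerSL ℝ e).hasFDerivAt
    have h2 : HasFDerivAt (fun x : E => inner ℝ e x * φ x) _ x :=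
      h1.mul (hφ.differentiable x).hasFDerivAt
    rw [h2.fderiv]
    simp [he]
  have hcross : Integrable (fun x => inner ℝ e x * φ x * fderiv ℝ φ x e) (volume.restrict Ω) := by
    have := hφ.contDiff_one.continuous_fderiv one_ne_zero
    have hc : Continuous fun x => inner ℝ e x * φ x * fderiv ℝ φ x e :=
      (hie.continuous.mul hφ.contDiff.continuous).mul (this.clm_apply continuous_const)
    exact (hc.integrable_of_hasCompactSupport
      (hφ.hasCompactSupport.fderiv_apply ℝ e).mul_left).restrict
  have key := setIntegral_mul_fderiv_eq_neg hΩ (hie.mul hφ.contDiff_one).contDiffOn hφ.contDiff_one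
    hφ.hasCompactSupport hφ.tsupport_subset e
  have hrhs : ∫ x in Ω, fderiv ℝ (fun x : E => inner ℝ e x * φ x) x e * φ x =
      (∫ x in Ω, inner ℝ e x * φ x * fderiv ℝ φ x e) + ∫ x in Ω, φ x ^ 2 := by
    rw [← integral_add hcross hsq]
    congr with x
    rw [hde]
    ring
  rw [hrhs] at key
  have hle : ∫ x in Ω, -(2 * (inner ℝ e x * φ x * fderiv ℝ φ x e)) ≤
      ∫ x in Ω, (1 / 2 * φ x ^ 2 + 2 * R ^ 2 * ‖gradient φ x‖ ^ 2) := by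
    refine setIntegral_mono_on (hcross.const_mul 2).neg
      ((hsq.const_mul _).add (hgr.const_mul _)) hΩ.measurableSet fun x hx => ?_
    have h1 : |inner ℝ e x| ≤ R := by
      simpa [he] using (abs_real_inner_le_norm e x).trans (by simpa [he] using hR x hx)
    have h2 : |fderiv ℝ φ x e| ≤ ‖gradient φ x‖ := by
      rw [← inner_gradient_left]
      simpa [he] using abs_real_inner_le_norm (gradient φ x) e
    have h3 : |inner ℝ e x * fderiv ℝ φ x e| ≤ R * ‖gradient φ x‖ := by
      rw [abs_mul]
      exact mul_le_mul h1 h2 (abs_nonneg _) ((abs_nonneg _).trans h1)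
    have h4 : (inner ℝ e x * fderiv ℝ φ x e) ^ 2 ≤ (R * ‖gradient φ x‖) ^ 2 :=
      sq_le_sq' (by linarith [neg_abs_le (inner ℝ e x * fderiv ℝ φ x e)])
        ((le_abs_self _).trans h3)
    -- With `t = ⟨e, x⟩ ∂ₑφ`, expanding `(φ + 2t)² ≥ 0` gives `-2tφ ≤ φ²/2 + 2t²`.
    nlinarith [sq_nonneg (φ x + 2 * (inner ℝ e x * fderiv ℝ φ x e))]
  rw [integral_neg, integral_const_mul, integral_add (hsq.const_mul _) (hgr.const_mul _),
    integral_const_mul, integral_const_mul] at hle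
  linarith

theorem norm_sq_toPair_fst {Ω : Set E} {u : E → ℝ} {G : E → E}
    (hu : MemLp u 2 (volume.restrict Ω)) (hG : MemLp G 2 (volume.restrict Ω)) :
    ‖(toPair hu hG).fst‖ ^ 2 = ∫ x in Ω, u x ^ 2 := by
  rw [norm_sq_L2_eq]
  refine integral_congr_ae ?_
  filter_upwards [toPair_fst hu hG] with x hx
  rw [hx, Real.norm_eq_abs, sq_abs]

theorem norm_sq_toPair_snd {Ω : Set E} {u : E → ℝ} {G : E → E}
    (hu : MemLp u 2 (volume.restrict Ω)) (hG : MemLp G 2 (volume.restrict Ω)) :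
    ‖(toPair hu hG).snd‖ ^ 2 = ∫ x in Ω, ‖G x‖ ^ 2 := by
  rw [norm_sq_L2_eq]
  refine integral_congr_ae ?_
  filter_upwards [toPair_snd hu hG] with x hx
  rw [hx]

theorem continuous_fst' (Ω : Set E) : Continuous fun a : L2Pair Ω => a.fst :=
  (WithLp.fstL 2 ℝ _ _).continuous

theorem continuous_snd' (Ω : Set E) : Continuous fun a : L2Pair Ω => a.snd :=
  (WithLp.sndL 2 ℝ _ _).continuous

theorem norm_sq_le_of_mem_h10Pairs [Nontrivial E] {Ω : Set E} (hΩ : IsOpen Ω) {R : ℝ}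
    (hR : ∀ x ∈ Ω, ‖x‖ ≤ R) {a : L2Pair Ω} (ha : a ∈ h10Pairs Ω) :
    ‖a‖ ^ 2 ≤ (4 * R ^ 2 + 1) * ‖a.snd‖ ^ 2 := by
  have h : ‖a.fst‖ ^ 2 ≤ 4 * R ^ 2 * ‖a.snd‖ ^ 2 := by
    refine h10Pairs_induction (p := fun a => ‖a.fst‖ ^ 2 ≤ 4 * R ^ 2 * ‖a.snd‖ ^ 2)
      (isClosed_le ((continuous_fst' Ω).norm.pow 2)
        (continuous_const.mul ((continuous_snd' Ω).norm.pow 2))) (fun φ hφ => ?_) ha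
    rw [norm_sq_toPair_fst, norm_sq_toPair_snd]
    exact hφ.poincare hΩ hR
  rw [WithLp.prod_norm_sq_eq_of_L2]
  linarith

/-! ### Existence and stability for the weak problem -/

/-- Lax–Milgram: by Poincaré's inequality the Dirichlet form is coercive on `H¹₀` for the full `H¹`
norm. -/
theorem exists_mem_h10Pairs_inner_snd_eq [Nontrivial E] {Ω : Set E} (hΩ : IsOpen Ω)
    (hb : Bornology.IsBounded Ω) (l : L2Pair Ω →L[ℝ] ℝ) :
    ∃ w ∈ h10Pairs Ω, ∀ b ∈ h10Pairs Ω, inner ℝ w.snd b.snd = l b := by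
  obtain ⟨R, hR⟩ := hb.exists_norm_le
  let P : h10Pairs Ω →L[ℝ] Lp E 2 (volume.restrict Ω) :=
    (WithLp.sndL 2 ℝ _ _).comp (h10Pairs Ω).subtypeL
  let B : h10Pairs Ω →L[ℝ] h10Pairs Ω →L[ℝ] ℝ := (innerSL ℝ).bilinearComp P P
  have hB : ∀ a b : h10Pairs Ω, B a b = inner ℝ (a : L2Pair Ω).snd (b : L2Pair Ω).snd :=
    fun a b => rfl
  have hpos : 0 < 4 * R ^ 2 + 1 := by positivity
  have hco : IsCoercive B := by
    refine ⟨(4 * R ^ 2 + 1)⁻¹, inv_pos.2 hpos, fun a => ?_⟩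
    rw [hB, real_inner_self_eq_norm_sq, mul_assoc, inv_mul_le_iff₀ hpos, ← pow_two]
    exact norm_sq_le_of_mem_h10Pairs hΩ hR a.2
  let l' := (InnerProductSpace.toDual ℝ (h10Pairs Ω)).symm (l.comp (h10Pairs Ω).subtypeL)
  let w := hco.continuousLinearEquivOfBilin.symm l'
  refine ⟨w, w.2, fun b hb => ?_⟩
  have h := hco.continuousLinearEquivOfBilin_apply w ⟨b, hb⟩
  rw [ContinuousLinearEquiv.apply_symm_apply, InnerProductSpace.toDual_symm_apply] at h
  exact (hB w ⟨b, hb⟩).symm.trans h.symm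

/-- Test with `b = a`: Poincaré and Cauchy–Schwarz give `‖a‖² ≤ (4R² + 1) ‖r‖ ‖a‖`, and one factor
`‖a‖` cancels. -/
theorem norm_le_of_mem_h10Pairs [Nontrivial E] {Ω : Set E} (hΩ : IsOpen Ω) {R : ℝ}
    (hR : ∀ x ∈ Ω, ‖x‖ ≤ R) {a : L2Pair Ω} (ha : a ∈ h10Pairs Ω)
    {r : Lp ℝ 2 (volume.restrict Ω)}
    (h : ∀ b ∈ h10Pairs Ω, inner ℝ a.snd b.snd = inner ℝ r b.fst) :
    ‖a‖ ≤ (4 * R ^ 2 + 1) * ‖r‖ := by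
  have h1 := norm_sq_le_of_mem_h10Pairs hΩ hR ha
  rw [← real_inner_self_eq_norm_sq a.snd, h a ha] at h1
  have h2 : ‖a.fst‖ ≤ ‖a‖ := WithLp.norm_fst_le _ a
  have h3 : inner ℝ r a.fst ≤ ‖r‖ * ‖a‖ :=
    (real_inner_le_norm _ _).trans (mul_le_mul_of_nonneg_left h2 (norm_nonneg _))
  have h4 : ‖a‖ ^ 2 ≤ (4 * R ^ 2 + 1) * ‖r‖ * ‖a‖ := by
    rw [mul_assoc]
    exact h1.trans (mul_le_mul_of_nonneg_left h3 (by positivity))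
  rcases (norm_nonneg a).eq_or_lt with h0 | h0
  · rw [← h0]
    positivity
  · rw [pow_two] at h4
    exact le_of_mul_le_mul_right h4 h0

/-! ### The Dirichlet problem in terms of pairs -/

theorem inner_L2_eq {F : Type*} [NormedAddCommGroup F] [InnerProductSpace ℝ F] {Ω : Set E}
    {f g : Lp F 2 (volume.restrict Ω)} {f' g' : E → F} (hf : f =ᵐ[volume.restrict Ω] f')
    (hg : g =ᵐ[volume.restrict Ω] g') : inner ℝ f g = ∫ x in Ω, inner ℝ (f' x) (g' x) := by
  rw [L2.inner_def]
  refine integral_congr_ae ?_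
  filter_upwards [hf, hg] with x h1 h2
  rw [h1, h2]

theorem inner_real_L2_eq {Ω : Set E} {f g : Lp ℝ 2 (volume.restrict Ω)} {f' g' : E → ℝ}
    (hf : f =ᵐ[volume.restrict Ω] f') (hg : g =ᵐ[volume.restrict Ω] g') :
    inner ℝ f g = ∫ x in Ω, f' x * g' x := by
  rw [inner_L2_eq hf hg]
  congr with x
  simp [mul_comm]

theorem isPoissonSolution_iff {Ω : Set E} (hΩ : IsOpen Ω) {f g u : E → ℝ} {a c : L2Pair Ω}
    (hf : MemLp f 2 (volume.restrict Ω)) (hc : IsH1Pair c g) (ha : IsH1Pair a u) :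
    IsPoissonSolution Ω f g u ↔ a - c ∈ h10Pairs Ω ∧
      ∀ b ∈ h10Pairs Ω, inner ℝ a.snd b.snd = inner ℝ (hf.toLp f) b.fst := by
  have key : ∀ {b : L2Pair Ω} {v : E → ℝ}, IsH1Pair b v →
      ((∫ x in Ω, inner ℝ (weakGrad Ω u x) (weakGrad Ω v x) = ∫ x in Ω, f x * v x) ↔
        inner ℝ a.snd b.snd = inner ℝ (hf.toLp f) b.fst) := fun hb => by
    rw [inner_L2_eq (ha.weakGrad_ae_eq hΩ).symm (hb.weakGrad_ae_eq hΩ).symm,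
      inner_real_L2_eq hf.coeFn_toLp hb.ae_eq]
  constructor
  · intro h
    refine ⟨((ha.sub hc).memH10_iff hΩ).1 h.boundary, fun b hb => ?_⟩
    have hb' := isH1Pair_of_mem_h10Pairs hΩ hb
    exact (key hb').1 (h.equation _ ((hb'.memH10_iff hΩ).2 hb))
  · rintro ⟨h1, h2⟩
    refine ⟨ha.memH1, ((ha.sub hc).memH10_iff hΩ).2 h1, fun v hv => ?_⟩
    obtain ⟨b, hb⟩ := hv.memH1.exists_isH1Pair
    exact (key hb).2 (h2 b ((hb.memH10_iff hΩ).1 hv))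

theorem exists_isPoissonSolution [Nontrivial E] {Ω : Set E} (hΩ : IsOpen Ω)
    (hb : Bornology.IsBounded Ω) {f g : E → ℝ} (hf : MemLp f 2 (volume.restrict Ω))
    (hg : MemH1 Ω g) : ∃ u, IsPoissonSolution Ω f g u := by
  obtain ⟨c, hc⟩ := hg.exists_isH1Pair
  -- Lifting of the boundary data: the solution is sought as `w + g` with `w` in `H¹₀`, so the
  -- functional is `v ↦ ∫ f v - ∫ ∇g·∇v`.
  obtain ⟨w, hw, h⟩ := exists_mem_h10Pairs_inner_snd_eq hΩ hb
    ((innerSL ℝ (hf.toLp f)).comp (WithLp.fstL 2 ℝ _ _) -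
      (innerSL ℝ c.snd).comp (WithLp.sndL 2 ℝ _ _))
  have ha := (isH1Pair_of_mem_h10Pairs hΩ hw).add hc
  refine ⟨_, (isPoissonSolution_iff hΩ hf hc ha).2 ⟨by rwa [add_sub_cancel_right], fun b hb => ?_⟩⟩
  have := h b hb
  simp only [WithLp.add_snd, inner_add_left, this]
  simp

theorem IsPoissonSolution.ae_eq [Nontrivial E] {Ω : Set E} (hΩ : IsOpen Ω)
    (hb : Bornology.IsBounded Ω) {f g u v : E → ℝ} (hf : MemLp f 2 (volume.restrict Ω))
    (hg : MemH1 Ω g) (hu : IsPoissonSolution Ω f g u) (hv : IsPoissonSolution Ω f g v) :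
    u =ᵐ[volume.restrict Ω] v := by
  obtain ⟨R, hR⟩ := hb.exists_norm_le
  obtain ⟨c, hc⟩ := hg.exists_isH1Pair
  obtain ⟨a, ha⟩ := hu.memH1.exists_isH1Pair
  obtain ⟨b, hb⟩ := hv.memH1.exists_isH1Pair
  obtain ⟨hu1, hu2⟩ := (isPoissonSolution_iff hΩ hf hc ha).1 hu
  obtain ⟨hv1, hv2⟩ := (isPoissonSolution_iff hΩ hf hc hb).1 hv
  have hab : a - b ∈ h10Pairs Ω := by simpa using sub_mem hu1 hv1
  have h := norm_le_of_mem_h10Pairs hΩ hR hab (r := 0) fun z hz => by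
    rw [WithLp.sub_snd, inner_sub_left, hu2 z hz, hv2 z hz, sub_self, inner_zero_left]
  rw [norm_zero, mul_zero, norm_le_zero_iff, sub_eq_zero] at h
  exact ha.ae_eq.symm.trans (h ▸ hb.ae_eq)

/-! ### Green's formula and the energy estimate for classical functions -/

theorem laplacian_eq_sum_fderiv {u : E → ℝ} (x : E) :
    Laplacian.laplacian u x = ∑ i, fderiv ℝ (fderiv ℝ u) x (stdOrthonormalBasis ℝ E i)
      (stdOrthonormalBasis ℝ E i) := by
  rw [InnerProductSpace.laplacian_eq_iteratedFDeriv_stdOrthonormalBasis]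
  simp [iteratedFDeriv_two_apply]

theorem continuousOn_laplacian {Ω : Set E} (hΩ : IsOpen Ω) {u : E → ℝ}
    (hu : ContDiffOn ℝ 2 u Ω) : ContinuousOn (Laplacian.laplacian u) Ω := by
  have h1 : ContDiffOn ℝ 1 (fderiv ℝ u) Ω := hu.fderiv_of_isOpen hΩ (by norm_num)
  have h2 := h1.continuousOn_fderiv_of_isOpen hΩ le_rfl
  refine (continuousOn_finsetSum Finset.univ fun i _ => (h2.clm_apply
    (continuousOn_const (c := stdOrthonormalBasis ℝ E i))).clm_apply
    (continuousOn_const (c := stdOrthonormalBasis ℝ E i))).congr fun x _ => ?_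
  exact laplacian_eq_sum_fderiv x

theorem setIntegral_inner_gradient_eq_neg {Ω : Set E} (hΩ : IsOpen Ω) {u φ : E → ℝ}
    (hu : ContDiffOn ℝ 2 u Ω) (hφ : IsTestFunction Ω φ) :
    ∫ x in Ω, inner ℝ (gradient u x) (gradient φ x) =
      -∫ x in Ω, Laplacian.laplacian u x * φ x := by
  let e := stdOrthonormalBasis ℝ E
  have h1 : ContDiffOn ℝ 1 (fderiv ℝ u) Ω := hu.fderiv_of_isOpen hΩ (by norm_num)
  have hi : ∀ i, ContDiffOn ℝ 1 (fun x => fderiv ℝ u x (e i)) Ω := fun i =>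
    h1.clm_apply contDiffOn_const
  have hd : ∀ i, Continuous fun x => fderiv ℝ φ x (e i) := fun i =>
    (hφ.contDiff_one.continuous_fderiv one_ne_zero).clm_apply continuous_const
  have e1 : ∀ x, inner ℝ (gradient u x) (gradient φ x) =
      ∑ i, fderiv ℝ u x (e i) * fderiv ℝ φ x (e i) := fun x => by
    rw [← e.sum_inner_mul_inner]
    simp
  have e2 : ∀ x ∈ Ω, Laplacian.laplacian u x * φ x =
      ∑ i, fderiv ℝ (fun x => fderiv ℝ u x (e i)) x (e i) * φ x := fun x hx => by
    rw [laplacian_eq_sum_fderiv, Finset.sum_mul]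
    refine Finset.sum_congr rfl fun i _ => ?_
    have := ((h1.differentiableOn one_ne_zero).differentiableAt
      (hΩ.mem_nhds hx)).hasFDerivAt.clm_apply (hasFDerivAt_const (e i) x)
    rw [this.fderiv]
    simp [e]
  simp_rw [e1]
  rw [setIntegral_congr_fun hΩ.measurableSet e2, integral_finsetSum, integral_finsetSum,
    ← Finset.sum_neg_distrib]
  · exact Finset.sum_congr rfl fun i _ => setIntegral_mul_fderiv_eq_neg hΩ (hi i)
      hφ.contDiff_one hφ.hasCompactSupport hφ.tsupport_subset (e i)
  · exact fun i _ => (integrable_mul_of_tsupport_subset hΩ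
      (((hi i).continuousOn_fderiv_of_isOpen hΩ le_rfl).clm_apply continuousOn_const)
      hφ.contDiff.continuous hφ.hasCompactSupport hφ.tsupport_subset).restrict
  · exact fun i _ => (integrable_mul_of_tsupport_subset hΩ (hi i).continuousOn (hd i)
      (hφ.hasCompactSupport.fderiv_apply ℝ _)
      ((tsupport_fderiv_apply_subset φ _).trans hφ.tsupport_subset)).restrict

/-- Green's formula holds against test functions, and both sides are continuous in `b`, so it passes
to the closure. Writing `-Δu` as residual plus `f` exhibits it as an element of `L²`. -/
theorem inner_snd_eq_of_contDiffOn {Ω : Set E} (hΩ : IsOpen Ω) {f u : E → ℝ} {a : L2Pair Ω}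
    (hf : MemLp f 2 (volume.restrict Ω)) (hu : ContDiffOn ℝ 2 u Ω)
    (hG : MemLp (gradient u) 2 (volume.restrict Ω)) (ha : IsH1Pair a u)
    (hr : MemLp (poissonResidual f u) 2 (volume.restrict Ω)) {b : L2Pair Ω}
    (hb : b ∈ h10Pairs Ω) :
    inner ℝ a.snd b.snd = inner ℝ (hr.toLp _ + hf.toLp f) b.fst := by
  refine h10Pairs_induction
    (p := fun b => inner ℝ a.snd b.snd = inner ℝ (hr.toLp _ + hf.toLp f) b.fst)
    (isClosed_eq (continuous_const.inner (continuous_snd' Ω))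
      (continuous_const.inner (continuous_fst' Ω))) (fun φ hφ => ?_) hb
  have hag : a.snd =ᵐ[volume.restrict Ω] gradient u :=
    ha.isWeakGradient.ae_eq hΩ (isWeakGradient_gradient hΩ (hu.of_le (by norm_num)) hG)
  rw [inner_L2_eq hag (toPair_snd _ _), inner_real_L2_eq
    ((Lp.coeFn_add _ _).trans (hr.coeFn_toLp.add hf.coeFn_toLp)) (toPair_fst _ _),
    setIntegral_inner_gradient_eq_neg hΩ hu hφ, ← integral_neg]
  congr with x
  simp [poissonResidual]

/-- The `H¹` distance of a classical function to the weak solution with the same boundary values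
is controlled by the `L²` norm of its residual. -/
theorem IsPoissonSolution.h1Norm_sub_le [Nontrivial E] {Ω : Set E} (hΩ : IsOpen Ω) {R : ℝ}
    (hR : ∀ x ∈ Ω, ‖x‖ ≤ R) {f g u w : E → ℝ} (hf : MemLp f 2 (volume.restrict Ω))
    (hg : MemH1 Ω g) (hw : IsPoissonSolution Ω f g w) (hu : ContDiffOn ℝ 2 u Ω)
    (hG : MemLp (gradient u) 2 (volume.restrict Ω)) (hu1 : MemH1 Ω u)
    (hug : MemH10 Ω (u - g)) (hr : MemLp (poissonResidual f u) 2 (volume.restrict Ω)) :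
    h1Norm Ω (u - w) ≤
      (4 * R ^ 2 + 1) * (eLpNorm (poissonResidual f u) 2 (volume.restrict Ω)).toReal := by
  obtain ⟨c, hc⟩ := hg.exists_isH1Pair
  obtain ⟨a, ha⟩ := hu1.exists_isH1Pair
  obtain ⟨b, hb⟩ := hw.memH1.exists_isH1Pair
  obtain ⟨hw1, hw2⟩ := (isPoissonSolution_iff hΩ hf hc hb).1 hw
  have hac := ((ha.sub hc).memH10_iff hΩ).1 hug
  have hab : a - b ∈ h10Pairs Ω := by simpa using sub_mem hac hw1
  rw [(ha.sub hb).h1Norm_eq hΩ, ← Lp.norm_toLp _ hr]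
  refine norm_le_of_mem_h10Pairs hΩ hR hab fun z hz => ?_
  rw [WithLp.sub_snd, inner_sub_left, hw2 z hz, inner_snd_eq_of_contDiffOn hΩ hf hu hG ha hr hz,
    inner_add_left, add_sub_cancel_right]

/-! ### Bounded `C¹` functions -/

theorem norm_gradient (u : E → ℝ) (x : E) : ‖gradient u x‖ = ‖fderiv ℝ u x‖ :=
  LinearIsometryEquiv.norm_map _ _

theorem continuousOn_gradient {Ω : Set E} (hΩ : IsOpen Ω) {u : E → ℝ} (hu : ContDiffOn ℝ 1 u Ω) :
    ContinuousOn (gradient u) Ω :=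
  (InnerProductSpace.toDual ℝ E).symm.continuous.comp_continuousOn
    (hu.continuousOn_fderiv_of_isOpen hΩ le_rfl)

theorem memLp_of_continuousOn_of_bound {F : Type*} [NormedAddCommGroup F] {Ω : Set E}
    (hΩ : IsOpen Ω) (hb : Bornology.IsBounded Ω) {k : E → F} (hk : ContinuousOn k Ω) {C : ℝ}
    (hC : ∀ x ∈ Ω, ‖k x‖ ≤ C) (p : ENNReal) : MemLp k p (volume.restrict Ω) := by
  have : IsFiniteMeasure (volume.restrict Ω) := isFiniteMeasure_restrict.2 hb.measure_lt_top.ne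
  exact MemLp.of_bound (hk.aestronglyMeasurable_of_isSeparable hΩ.measurableSet
    (TopologicalSpace.IsSeparable.of_separableSpace Ω)) C
    ((ae_restrict_iff' hΩ.measurableSet).2 (.of_forall hC))

theorem setIntegral_norm_sq_le {F : Type*} [NormedAddCommGroup F] {Ω : Set E}
    (hb : Bornology.IsBounded Ω) {k : E → F} {C : ℝ} (hC : ∀ x, ‖k x‖ ≤ C) :
    ∫ x in Ω, ‖k x‖ ^ 2 ≤ C ^ 2 * volume.real Ω := by
  refine (Real.le_norm_self _).trans (norm_setIntegral_le_of_norm_le_const hb.measure_lt_top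
    fun x _ => ?_)
  rw [norm_pow, norm_norm]
  exact pow_le_pow_left₀ (norm_nonneg _) (hC x) 2

theorem norm_smul_le_of_norm_le {F : Type*} [NormedAddCommGroup F] [NormedSpace ℝ F] {c C D : ℝ}
    {x : F} (hc : ‖c‖ ≤ C) (hx : ‖x‖ ≤ D) : ‖c • x‖ ≤ C * D :=
  (norm_smul_le c x).trans (mul_le_mul hc hx (norm_nonneg _) ((norm_nonneg _).trans hc))

/-- `u` is of class `C¹` in `Ω` and bounded there together with its derivative. -/
structure IsBoundedC1 (Ω : Set E) (u : E → ℝ) : Prop where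
  contDiffOn : ContDiffOn ℝ 1 u Ω
  bound : ∃ C, ∀ x ∈ Ω, ‖u x‖ ≤ C
  fderiv_bound : ∃ C, ∀ x ∈ Ω, ‖fderiv ℝ u x‖ ≤ C

namespace IsBoundedC1

variable {Ω : Set E} {u w : E → ℝ}

theorem differentiableAt (hΩ : IsOpen Ω) (hu : IsBoundedC1 Ω u) {x : E} (hx : x ∈ Ω) :
    DifferentiableAt ℝ u x :=
  (hu.contDiffOn.differentiableOn one_ne_zero).differentiableAt (hΩ.mem_nhds hx)

theorem memLp (hΩ : IsOpen Ω) (hb : Bornology.IsBounded Ω) (hu : IsBoundedC1 Ω u) :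
    MemLp u 2 (volume.restrict Ω) :=
  let ⟨_, hC⟩ := hu.bound
  memLp_of_continuousOn_of_bound hΩ hb hu.contDiffOn.continuousOn hC 2

theorem memLp_gradient (hΩ : IsOpen Ω) (hb : Bornology.IsBounded Ω) (hu : IsBoundedC1 Ω u) :
    MemLp (gradient u) 2 (volume.restrict Ω) :=
  let ⟨_, hC⟩ := hu.fderiv_bound
  memLp_of_continuousOn_of_bound hΩ hb (continuousOn_gradient hΩ hu.contDiffOn)
    (fun x hx => (norm_gradient u x).trans_le (hC x hx)) 2

theorem isH1Pair (hΩ : IsOpen Ω) (hb : Bornology.IsBounded Ω) (hu : IsBoundedC1 Ω u) :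
    IsH1Pair (toPair (hu.memLp hΩ hb) (hu.memLp_gradient hΩ hb)) u :=
  isH1Pair_toPair (hu.memLp hΩ hb)
    (isWeakGradient_gradient hΩ hu.contDiffOn (hu.memLp_gradient hΩ hb))

theorem memH1 (hΩ : IsOpen Ω) (hb : Bornology.IsBounded Ω) (hu : IsBoundedC1 Ω u) : MemH1 Ω u :=
  (hu.isH1Pair hΩ hb).memH1

theorem h1Norm_sq (hΩ : IsOpen Ω) (hb : Bornology.IsBounded Ω) (hu : IsBoundedC1 Ω u) :
    h1Norm Ω u ^ 2 = (∫ x in Ω, ‖u x‖ ^ 2) + ∫ x in Ω, ‖fderiv ℝ u x‖ ^ 2 := by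
  rw [(hu.isH1Pair hΩ hb).h1Norm_eq hΩ, WithLp.prod_norm_sq_eq_of_L2, norm_sq_toPair_fst,
    norm_sq_toPair_snd]
  simp [norm_gradient]

theorem add (hΩ : IsOpen Ω) (hu : IsBoundedC1 Ω u) (hw : IsBoundedC1 Ω w) :
    IsBoundedC1 Ω (fun x => u x + w x) := by
  obtain ⟨C, hC⟩ := hu.bound
  obtain ⟨D, hD⟩ := hw.bound
  obtain ⟨C', hC'⟩ := hu.fderiv_bound
  obtain ⟨D', hD'⟩ := hw.fderiv_bound
  refine ⟨hu.contDiffOn.add hw.contDiffOn, ⟨C + D, fun x hx => norm_add_le_of_le (hC x hx) (hD x hx)⟩,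
    C' + D', fun x hx => ?_⟩
  rw [fderiv_fun_add (hu.differentiableAt hΩ hx) (hw.differentiableAt hΩ hx)]
  exact norm_add_le_of_le (hC' x hx) (hD' x hx)

theorem mul (hΩ : IsOpen Ω) (hu : IsBoundedC1 Ω u) (hw : IsBoundedC1 Ω w) :
    IsBoundedC1 Ω (fun x => u x * w x) := by
  obtain ⟨C, hC⟩ := hu.bound
  obtain ⟨D, hD⟩ := hw.bound
  obtain ⟨C', hC'⟩ := hu.fderiv_bound
  obtain ⟨D', hD'⟩ := hw.fderiv_bound
  refine ⟨hu.contDiffOn.mul hw.contDiffOn, ⟨C * D, fun x hx => norm_mul_le_of_le (hC x hx) (hD x hx)⟩,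
    C * D' + D * C', fun x hx => ?_⟩
  rw [fderiv_fun_mul (hu.differentiableAt hΩ hx) (hw.differentiableAt hΩ hx)]
  refine norm_add_le_of_le ?_ ?_
  · exact norm_smul_le_of_norm_le (hC x hx) (hD' x hx)
  · exact norm_smul_le_of_norm_le (hD x hx) (hC' x hx)

end IsBoundedC1

theorem isBoundedC1_of_contDiff {Ω : Set E} (hb : Bornology.IsBounded Ω) {u : E → ℝ}
    (hu : ContDiff ℝ 1 u) : IsBoundedC1 Ω u := by
  have hK : IsCompact (closure Ω) := hb.isCompact_closure
  obtain ⟨C, hC⟩ := hK.exists_bound_of_continuousOn hu.continuous.continuousOn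
  obtain ⟨D, hD⟩ := hK.exists_bound_of_continuousOn (hu.continuous_fderiv one_ne_zero).continuousOn
  exact ⟨hu.contDiffOn, ⟨C, fun x hx => hC x (subset_closure hx)⟩,
    D, fun x hx => hD x (subset_closure hx)⟩

theorem MemCk.isBoundedC1 {Ω : Set E} (hb : Bornology.IsBounded Ω) {k : ℕ} (hk : 1 ≤ k)
    {u : E → ℝ} (hu : MemCk k Ω u) : IsBoundedC1 Ω u := by
  have hK : IsCompact (closure Ω) := hb.isCompact_closure
  obtain ⟨C, hC⟩ := hK.exists_bound_of_continuousOn hu.continuousOn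
  obtain ⟨G, hG, hGu⟩ := hu.extend 1 hk
  obtain ⟨D, hD⟩ := hK.exists_bound_of_continuousOn hG
  refine ⟨hu.contDiffOn.of_le (by exact_mod_cast hk), ⟨C, fun x hx => hC x (subset_closure hx)⟩,
    D, fun x hx => ?_⟩
  rw [← norm_iteratedFDeriv_one, hGu hx]
  exact hD x (subset_closure hx)

theorem memCk_of_contDiff {k : ℕ} {Ω : Set E} {u : E → ℝ} (hu : ContDiff ℝ k u) :
    MemCk k Ω u where
  continuousOn := hu.continuous.continuousOn
  contDiffOn := hu.contDiffOn
  extend i hi := ⟨iteratedFDeriv ℝ i u,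
    (hu.continuous_iteratedFDeriv (by exact_mod_cast hi)).continuousOn, fun _ _ => rfl⟩

/-! ### Approximation by test functions -/

/-- A compactly supported `C¹` function is approximated uniformly, together with its derivative,
by test functions. -/
theorem exists_isTestFunction_dist_le {Ω : Set E} (hΩ : IsOpen Ω) {ψ : E → ℝ}
    (hψ : ContDiff ℝ 1 ψ) (hc : HasCompactSupport ψ) (hs : tsupport ψ ⊆ Ω) {η : ℝ} (hη : 0 < η) :
    ∃ φ, IsTestFunction Ω φ ∧ ∀ x, ‖ψ x - φ x‖ ≤ η ∧ ‖fderiv ℝ ψ x - fderiv ℝ φ x‖ ≤ η := by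
  have hψ' : Continuous (fderiv ℝ ψ) := hψ.continuous_fderiv one_ne_zero
  obtain ⟨δ₀, hδ₀, hsub⟩ := IsCompact.exists_cthickening_subset_open hc hΩ hs
  obtain ⟨δ₁, hδ₁, h₁⟩ := Metric.uniformContinuous_iff.1
    (HasCompactSupport.uniformContinuous_of_continuous hc hψ.continuous) η hη
  obtain ⟨δ₂, hδ₂, h₂⟩ := Metric.uniformContinuous_iff.1
    (HasCompactSupport.uniformContinuous_of_continuous (hc.fderiv ℝ) hψ') η hη
  obtain ⟨δ, hδ, hδ'⟩ : ∃ δ, 0 < δ ∧ δ ≤ min δ₀ (min δ₁ δ₂) :=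
    ⟨_, lt_min hδ₀ (lt_min hδ₁ hδ₂), le_rfl⟩
  obtain ⟨hd0, hd1, hd2⟩ : δ ≤ δ₀ ∧ δ ≤ δ₁ ∧ δ ≤ δ₂ := by simpa using hδ'
  -- Mollification at scale `δ`: it keeps the support within the `δ₀`-thickening inside `Ω`, and
  -- uniform continuity of `ψ` and of its derivative bounds both errors by `η`.
  let ρ : ContDiffBump (0 : E) := ⟨δ / 2, δ, half_pos hδ, half_lt_self hδ⟩
  have hρl : LocallyIntegrable (ρ.normed volume) volume :=
    (ρ.integrable_normed (μ := volume)).locallyIntegrable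
  let L := ContinuousLinearMap.lsmul ℝ ℝ (E := ℝ)
  let φ : E → ℝ := convolution (ρ.normed volume) ψ L volume
  have hL : L.precompR E = ContinuousLinearMap.lsmul ℝ ℝ (E := E →L[ℝ] ℝ) := by
    ext a T
    simp [L, ContinuousLinearMap.precompR_apply]
  have hφ' : ∀ x, fderiv ℝ φ x = convolution (ρ.normed volume) (fderiv ℝ ψ)
      (ContinuousLinearMap.lsmul ℝ ℝ) volume x := fun x => by
    rw [(hc.hasFDerivAt_convolution_right L hρl hψ x).fderiv, hL]
  refine ⟨φ, ⟨?_, ?_, ?_⟩, fun x => ⟨?_, ?_⟩⟩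
  · exact ρ.hasCompactSupport_normed.contDiff_convolution_left _ ρ.contDiff_normed
      hψ.continuous.locallyIntegrable
  · exact ρ.hasCompactSupport_normed.convolution _ hc
  · refine (closure_minimal ?_ Metric.isClosed_cthickening).trans
      ((Metric.cthickening_mono hd0 _).trans hsub)
    refine (support_convolution_subset _).trans ?_
    rintro _ ⟨y, hy, z, hz, rfl⟩
    rw [ρ.support_normed_eq, mem_ball_zero_iff] at hy
    refine Metric.mem_cthickening_of_dist_le _ z _ _ (subset_tsupport _ hz) ?_
    simpa using hy.le
  · rw [← dist_eq_norm, dist_comm]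
    exact ρ.dist_normed_convolution_le hψ.continuous.aestronglyMeasurable
      fun y hy => (h₁ (lt_of_lt_of_le (Metric.mem_ball.1 hy) hd1)).le
  · rw [← dist_eq_norm, dist_comm, hφ']
    exact ρ.dist_normed_convolution_le hψ'.aestronglyMeasurable
      fun y hy => (h₂ (lt_of_lt_of_le (Metric.mem_ball.1 hy) hd2)).le

theorem memH10_of_contDiff_of_hasCompactSupport {Ω : Set E} (hΩ : IsOpen Ω)
    (hb : Bornology.IsBounded Ω) {ψ : E → ℝ} (hψ : ContDiff ℝ 1 ψ) (hc : HasCompactSupport ψ)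
    (hs : tsupport ψ ⊆ Ω) : MemH10 Ω ψ := by
  refine ⟨(isBoundedC1_of_contDiff hb hψ).memH1 hΩ hb, fun ε hε => ?_⟩
  let V := volume.real Ω
  have hV : 0 ≤ V := measureReal_nonneg
  -- Each of the two squared `L²` errors is then at most `ε² / 4`; `V + 1` in place of `V` also
  -- covers `V = 0`.
  have hη : 0 < ε / (2 * (V + 1)) := by positivity
  obtain ⟨φ, hφ, h⟩ := exists_isTestFunction_dist_le hΩ hψ hc hs hη
  refine ⟨φ, hφ, lt_of_pow_lt_pow_left₀ 2 hε.le ?_⟩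
  have hsm : ContDiff ℝ 1 (ψ - φ) := hψ.sub hφ.contDiff_one
  rw [(isBoundedC1_of_contDiff hb hsm).h1Norm_sq hΩ hb]
  have h1 := setIntegral_norm_sq_le hb (k := ψ - φ) fun x => (h x).1
  have h2 := setIntegral_norm_sq_le hb (k := fderiv ℝ (ψ - φ)) (C := ε / (2 * (V + 1))) fun x => by
    rw [fderiv_sub (hψ.differentiable one_ne_zero x) (hφ.differentiable x)]
    exact (h x).2
  have h3 : (ε / (2 * (V + 1))) ^ 2 * V = ε ^ 2 * (V / (4 * (V + 1) ^ 2)) := by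
    field_simp
    ring
  have h4 : V / (4 * (V + 1) ^ 2) ≤ 1 / 4 := by
    rw [div_le_div_iff₀ (by positivity) (by norm_num)]
    nlinarith
  have h5 := mul_le_mul_of_nonneg_left h4 (sq_nonneg ε)
  nlinarith [sq_pos_of_pos hε]

/-- The products `(1 - χ(c d)) w` with a cutoff `χ` near zero belong to `H¹₀`. -/
theorem memH10_cutoff {Ω : Set E} (hΩ : IsOpen Ω) (hb : Bornology.IsBounded Ω) {d w : E → ℝ}
    (hd : ContinuousOn d (closure Ω)) (hd0 : ∀ x ∈ frontier Ω, d x = 0)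
    (hd1 : ContDiffOn ℝ 1 d Ω) (hw : ContDiffOn ℝ 1 w Ω) {χ : ℝ → ℝ} (hχ : ContDiff ℝ 1 χ)
    (hχ1 : ∀ t, |t| ≤ 1 → χ t = 1) (c : ℝ) :
    MemH10 Ω (Ω.indicator fun x => w x - χ (c * d x) * w x) := by
  let F : E → ℝ := fun x => w x - χ (c * d x) * w x
  -- Outside `K` the cutoff equals `1` and the function vanishes. `K` is compact and avoids the
  -- frontier, where `d = 0`, so it is a compact subset of `Ω`.
  let K : Set E := closure Ω ∩ (fun x => |c * d x|) ⁻¹' Ici 1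
  have hKc : IsCompact K := by
    refine hb.isCompact_closure.of_isClosed_subset ?_ inter_subset_left
    exact ContinuousOn.preimage_isClosed_of_isClosed (continuousOn_const.mul hd).abs
      isClosed_closure isClosed_Ici
  have hKΩ : K ⊆ Ω := fun x hx => by
    by_contra hxΩ
    have hfr : x ∈ frontier Ω := by rw [hΩ.frontier_eq]; exact ⟨hx.1, hxΩ⟩
    have := hx.2
    simp only [mem_preimage, hd0 x hfr, mul_zero, abs_zero, mem_Ici] at this
    linarith
  have hsupp : tsupport (Ω.indicator F) ⊆ K := by
    refine closure_minimal (fun x hx => ?_) hKc.isClosed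
    rw [Function.mem_support] at hx
    have hxΩ : x ∈ Ω := by
      by_contra h
      exact hx (indicator_of_notMem h _)
    refine ⟨subset_closure hxΩ, ?_⟩
    by_contra h
    refine hx ?_
    rw [indicator_of_mem hxΩ]
    simp only [mem_preimage, mem_Ici, not_le] at h
    simp [F, hχ1 _ h.le]
  have hF : ContDiffOn ℝ 1 F Ω :=
    hw.sub ((hχ.comp_contDiffOn (contDiffOn_const.mul hd1)).mul hw)
  refine memH10_of_contDiff_of_hasCompactSupport hΩ hb
    (contDiff_iff_contDiffAt.2 fun x => ?_) (hKc.of_isClosed_subset isClosed_closure hsupp)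
    (hsupp.trans hKΩ)
  by_cases hx : x ∈ Ω
  · refine (hF.contDiffAt (hΩ.mem_nhds hx)).congr_of_eventuallyEq ?_
    filter_upwards [hΩ.mem_nhds hx] with y hy
    exact indicator_of_mem hy _
  · have hx' : x ∉ tsupport (Ω.indicator F) := fun h => hx (hKΩ (hsupp h))
    exact contDiffAt_const.congr_of_eventuallyEq (notMem_tsupport_iff_eventuallyEq.1 hx')

theorem tendsto_setIntegral_norm_sq {F : Type*} [NormedAddCommGroup F] {Ω : Set E}
    (hΩ : IsOpen Ω) (hb : Bornology.IsBounded Ω) {k : ℕ → E → F}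
    (hk : ∀ n, ContinuousOn (k n) Ω) {C : ℝ} (hC : ∀ n, ∀ x ∈ Ω, ‖k n x‖ ≤ C)
    (hlim : ∀ x ∈ Ω, Filter.Tendsto (fun n => k n x) Filter.atTop (nhds 0)) :
    Filter.Tendsto (fun n => ∫ x in Ω, ‖k n x‖ ^ 2) Filter.atTop (nhds 0) := by
  have : IsFiniteMeasure (volume.restrict Ω) := isFiniteMeasure_restrict.2 hb.measure_lt_top.ne
  rw [← integral_zero E ℝ (μ := volume.restrict Ω)]
  refine tendsto_integral_of_dominated_convergence (fun _ => C ^ 2)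
    (fun n => ((hk n).norm.pow 2).aestronglyMeasurable hΩ.measurableSet) (integrable_const _)
    (fun n => ?_) ?_
  · refine (ae_restrict_iff' hΩ.measurableSet).2 (.of_forall fun x hx => ?_)
    rw [norm_pow, norm_norm]
    exact pow_le_pow_left₀ (norm_nonneg _) (hC n x hx) 2
  · refine (ae_restrict_iff' hΩ.measurableSet).2 (.of_forall fun x hx => ?_)
    simpa using ((hlim x hx).norm.pow 2)

/-- If `d` vanishes on the boundary of `Ω` but nowhere in `Ω`, then `d n ∈ H¹₀(Ω)`. -/
theorem memH10_mul {Ω : Set E} (hΩ : IsOpen Ω) (hb : Bornology.IsBounded Ω) {d n : E → ℝ}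
    (hd : ContinuousOn d (closure Ω)) (hd0 : ∀ x ∈ frontier Ω, d x = 0)
    (hd1 : ∀ x ∈ Ω, d x ≠ 0) (hdC : IsBoundedC1 Ω d) (hn : IsBoundedC1 Ω n) :
    MemH10 Ω (fun x => d x * n x) := by
  let w : E → ℝ := fun x => d x * n x
  have hw : IsBoundedC1 Ω w := hdC.mul hΩ hn
  let χ : ContDiffBump (0 : ℝ) := ⟨1, 2, one_pos, one_lt_two⟩
  have hχC : ContDiff ℝ 1 χ := χ.contDiff
  have hχ1 : ∀ t, |t| ≤ 1 → χ t = 1 := fun t ht => χ.one_of_mem_closedBall (by simpa using ht)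
  have hχ0 : ∀ t, 2 < |t| → χ t = 0 := fun t ht => χ.zero_of_le_dist (by simpa using ht.le)
  have hχd : ∀ t, 2 < |t| → deriv χ t = 0 := fun t ht => by
    have : χ =ᶠ[nhds t] fun _ => 0 := by
      filter_upwards [(isOpen_lt continuous_const continuous_abs).mem_nhds ht] with s hs
      exact hχ0 s hs
    rw [this.deriv_eq, deriv_const]
  have hχn : ∀ t, ‖χ t‖ ≤ 1 := fun t => by
    rw [Real.norm_of_nonneg χ.nonneg]
    exact χ.le_one
  -- Differentiating `χ(j d)` produces a factor `j`, but `w = d n` turns `j d χ'(j d)` into `t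
  -- χ'(t)` with `t = j d`, which is bounded uniformly in `j`.
  obtain ⟨T, hT⟩ : ∃ T, ∀ t, ‖t * deriv χ t‖ ≤ T :=
    (continuous_id.mul (hχC.continuous_deriv le_rfl)).bounded_above_of_compact_support
      χ.hasCompactSupport.deriv.mul_left
  let z : ℕ → E → ℝ := fun j x => χ (j * d x) * w x
  have hlarge : ∀ x ∈ Ω, ∀ᶠ j : ℕ in Filter.atTop, 2 < |j * d x| := fun x hx => by
    have hp : 0 < |d x| := abs_pos.2 (hd1 x hx)
    filter_upwards [(tendsto_natCast_atTop_atTop (R := ℝ)).eventually_gt_atTop (2 / |d x|)]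
      with j hj
    rw [abs_mul, Nat.abs_cast]
    exact (div_lt_iff₀ hp).1 hj
  have hzd : ∀ j, ∀ x ∈ Ω, fderiv ℝ (z j) x = χ (j * d x) • fderiv ℝ w x +
      (n x * ((j * d x) * deriv χ (j * d x))) • fderiv ℝ d x := fun j x hx => by
    have h1 : HasFDerivAt (fun y => (j : ℝ) * d y) ((j : ℝ) • fderiv ℝ d x) x :=
      (hdC.differentiableAt hΩ hx).hasFDerivAt.const_mul _
    have h2 : HasFDerivAt (fun y => χ (j * d y)) (deriv χ (j * d x) • (j : ℝ) • fderiv ℝ d x) x :=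
      ((hχC.differentiable one_ne_zero _).hasDerivAt).comp_hasFDerivAt x h1
    have h3 : HasFDerivAt (z j) _ x := h2.mul (hw.differentiableAt hΩ hx).hasFDerivAt
    rw [h3.fderiv]
    simp only [smul_smul, w]
    congr 2
    ring
  obtain ⟨A, hA⟩ := hw.bound
  obtain ⟨B, hB⟩ := hw.fderiv_bound
  obtain ⟨N, hN⟩ := hn.bound
  obtain ⟨D, hD⟩ := hdC.fderiv_bound
  have hzb : ∀ j, ∀ x ∈ Ω, ‖z j x‖ ≤ 1 * A := fun j x hx => norm_mul_le_of_le (hχn _) (hA x hx)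
  have hzdb : ∀ j, ∀ x ∈ Ω, ‖fderiv ℝ (z j) x‖ ≤ 1 * B + N * T * D := fun j x hx => by
    rw [hzd j x hx]
    exact norm_add_le_of_le (norm_smul_le_of_norm_le (hχn _) (hB x hx))
      (norm_smul_le_of_norm_le (norm_mul_le_of_le (hN x hx) (hT _)) (hD x hx))
  have hz : ∀ j, IsBoundedC1 Ω (z j) := fun j =>
    ⟨(hχC.comp_contDiffOn (contDiffOn_const.mul hdC.contDiffOn)).mul hw.contDiffOn,
      ⟨_, hzb j⟩, _, hzdb j⟩
  -- Dominated convergence: at each point of `Ω`, `d ≠ 0` forces `|j d| > 2` eventually, so `z j`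
  -- and its derivative vanish there for large `j`.
  have hlim : Filter.Tendsto (fun j => h1Norm Ω (z j) ^ 2) Filter.atTop (nhds 0) := by
    simp_rw [fun j => (hz j).h1Norm_sq hΩ hb]
    rw [← add_zero (0 : ℝ)]
    refine (tendsto_setIntegral_norm_sq hΩ hb (fun j => (hz j).contDiffOn.continuousOn) hzb
      fun x hx => ?_).add (tendsto_setIntegral_norm_sq hΩ hb
      (fun j => (hz j).contDiffOn.continuousOn_fderiv_of_isOpen hΩ le_rfl) hzdb fun x hx => ?_)
    · refine tendsto_const_nhds.congr' ?_
      filter_upwards [hlarge x hx] with j hj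
      simp [z, hχ0 _ hj]
    · refine tendsto_const_nhds.congr' ?_
      filter_upwards [hlarge x hx] with j hj
      simp [hzd j x hx, hχ0 _ hj, hχd _ hj]
  have ha := hw.isH1Pair hΩ hb
  refine (ha.memH10_iff hΩ).2 ?_
  have hmem : ∀ j, toPair (hw.memLp hΩ hb) (hw.memLp_gradient hΩ hb) -
      toPair ((hz j).memLp hΩ hb) ((hz j).memLp_gradient hΩ hb) ∈ h10Pairs Ω := fun j => by
    have h1 : w - z j =ᵐ[volume.restrict Ω]
        Ω.indicator fun x => w x - χ (j * d x) * w x :=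
      (ae_restrict_iff' hΩ.measurableSet).2 (.of_forall fun x hx => by
        rw [indicator_of_mem hx]
        rfl)
    exact (((ha.sub ((hz j).isH1Pair hΩ hb)).congr h1).memH10_iff hΩ).1
      (memH10_cutoff hΩ hb hd hd0 hdC.contDiffOn hw.contDiffOn hχC hχ1 j)
  -- The functions `w - z j` lie in the closed space `H¹₀` and converge to `w`.
  refine (isClosed_h10Pairs Ω).mem_of_tendsto (b := Filter.atTop) ?_ (.of_forall hmem)
  rw [tendsto_iff_norm_sub_tendsto_zero]
  have h2 := hlim.sqrt
  rw [Real.sqrt_zero] at h2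
  refine h2.congr fun j => ?_
  rw [((hz j).isH1Pair hΩ hb).h1Norm_eq hΩ, Real.sqrt_sq (norm_nonneg _), sub_sub_cancel_left,
    norm_neg]

/-! ### The generalized loss controls the `L²` norm of the residual -/

theorem exists_eLpNorm_le_of_generalizedLoss_lt {Ω : Set E} (hb : Bornology.IsBounded Ω)
    {p : ENNReal} (hp : p ≠ 0) {η : ℝ} (hη : 0 < η) :
    ∃ δ : ℝ, 0 < δ ∧ ∀ f u : E → ℝ, generalizedLoss Ω f p u < ENNReal.ofReal δ →
      eLpNorm (poissonResidual f u) p (volume.restrict Ω) ≤ ENNReal.ofReal η := by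
  by_cases hp' : p = ⊤
  · refine ⟨η, hη, fun f u h => ?_⟩
    rw [generalizedLoss, if_pos hp'] at h
    rw [hp']
    exact h.le
  have hV : volume Ω ≠ ⊤ := hb.measure_lt_top.ne
  have hq : 0 < p.toReal := ENNReal.toReal_pos hp hp'
  have hV0 : 0 ≤ (volume Ω).toReal := ENNReal.toReal_nonneg
  refine ⟨η ^ p.toReal / ((volume Ω).toReal + 1), by positivity, fun f u h => ?_⟩
  rw [generalizedLoss, if_neg hp'] at h
  rw [eLpNorm_eq_lintegral_rpow_enorm_toReal hp hp', one_div, ENNReal.rpow_inv_le_iff hq,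
    ENNReal.ofReal_rpow_of_pos hη]
  -- If `Ω` is null, its inverse measure is `⊤` and cannot be cancelled; the integral is then zero
  -- anyway.
  rcases eq_or_ne (volume Ω) 0 with h0 | h0
  · rw [Measure.restrict_eq_zero.2 h0, lintegral_zero_measure]
    exact zero_le
  calc ∫⁻ x in Ω, ‖poissonResidual f u x‖ₑ ^ p.toReal
      = volume Ω * ((volume Ω)⁻¹ * ∫⁻ x in Ω, ‖poissonResidual f u x‖ₑ ^ p.toReal) := by
        rw [← mul_assoc, ENNReal.mul_inv_cancel h0 hV, one_mul]
    _ ≤ ENNReal.ofReal (volume Ω).toReal *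
          ENNReal.ofReal (η ^ p.toReal / ((volume Ω).toReal + 1)) := by
        rw [ENNReal.ofReal_toReal hV]
        gcongr
    _ ≤ ENNReal.ofReal (η ^ p.toReal) := by
        rw [← ENNReal.ofReal_mul hV0]
        refine ENNReal.ofReal_le_ofReal ?_
        rw [mul_div_assoc', div_le_iff₀ (by positivity)]
        nlinarith [Real.rpow_pos_of_pos hη p.toReal]

theorem exists_eLpNorm_two_le_of_generalizedLoss_lt {Ω : Set E} (hb : Bornology.IsBounded Ω)
    {p : ENNReal} (hp : 2 ≤ p) {η : ℝ} (hη : 0 < η) :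
    ∃ δ : ℝ, 0 < δ ∧ ∀ f u : E → ℝ,
      AEStronglyMeasurable (poissonResidual f u) (volume.restrict Ω) →
      generalizedLoss Ω f p u < ENNReal.ofReal δ →
      eLpNorm (poissonResidual f u) 2 (volume.restrict Ω) ≤ ENNReal.ofReal η := by
  have hexp : 0 ≤ 1 / (2 : ENNReal).toReal - 1 / p.toReal := by
    by_cases hp' : p = ⊤
    · simp [hp']
    · rw [sub_nonneg]
      exact one_div_le_one_div_of_le (by norm_num) (ENNReal.toReal_mono hp' hp)
  -- Hölder constant `|Ω|^(1/2 - 1/p)`. For `p = ⊤` the conventions `⊤.toReal = 0` and `1 / 0 = 0`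
  -- give the right exponent `1/2`.
  let κ := volume.restrict Ω univ ^ (1 / (2 : ENNReal).toReal - 1 / p.toReal)
  have hκ : κ ≠ ⊤ := by
    refine ENNReal.rpow_ne_top_of_nonneg hexp ?_
    rw [Measure.restrict_apply_univ]
    exact hb.measure_lt_top.ne
  have hκ0 : 0 ≤ κ.toReal := ENNReal.toReal_nonneg
  obtain ⟨δ, hδ, h⟩ := exists_eLpNorm_le_of_generalizedLoss_lt hb (p := p)
    (two_pos.trans_le hp).ne' (η := η / (κ.toReal + 1)) (by positivity)
  refine ⟨δ, hδ, fun f u hm hl => (eLpNorm_le_eLpNorm_mul_rpow_measure_univ hp hm).trans ?_⟩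
  calc _ ≤ ENNReal.ofReal (η / (κ.toReal + 1)) * ENNReal.ofReal κ.toReal := by
        rw [ENNReal.ofReal_toReal hκ]
        exact mul_le_mul_left (h f u hl) κ
    _ ≤ ENNReal.ofReal η := by
        rw [← ENNReal.ofReal_mul (by positivity)]
        refine ENNReal.ofReal_le_ofReal ?_
        rw [div_mul_eq_mul_div, div_le_iff₀ (by positivity)]
        nlinarith

end Sobolev

/-! ### The ansatz functions -/

theorem contDiff_tanh {n : WithTop ℕ∞} : ContDiff ℝ n Real.tanh := by
  have h : Real.tanh = fun x => Real.sinh x / Real.cosh x := funext Real.tanh_eq_sinh_div_cosh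
  rw [h]
  exact Real.contDiff_sinh.div Real.contDiff_cosh fun x => (Real.cosh_pos x).ne'

theorem contDiff_affine {n : WithTop ℕ∞} {i o : ℕ} (W : Matrix (Fin o) (Fin i) ℝ)
    (b : Fin o → ℝ) : ContDiff ℝ n fun x => W.mulVec x + b :=
  (LinearMap.toContinuousLinearMap W.mulVecLin).contDiff.add contDiff_const

theorem Network.contDiff_eval {k : WithTop ℕ∞} {n o : ℕ} (N : Network n o) :
    ContDiff ℝ k N.eval := by
  induction N with
  | last W b => exact contDiff_affine W b
  | layer W b rest ih =>
    exact ih.comp (contDiff_pi.2 fun j =>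
      contDiff_tanh.comp ((contDiff_apply ℝ ℝ j).comp (contDiff_affine W b)))

theorem Network.contDiff_eval_euclidean {k : WithTop ℕ∞} {m : ℕ} (N : Network m 1) :
    ContDiff ℝ k fun x : EuclideanSpace ℝ (Fin m) => N.eval (fun i => x i) 0 :=
  (contDiff_apply ℝ ℝ 0).comp (N.contDiff_eval.comp
    (PiLp.continuousLinearEquiv 2 ℝ fun _ : Fin m => ℝ).contDiff)

variable {m : ℕ} {Ω : Set (EuclideanSpace ℝ (Fin m))} {d g : EuclideanSpace ℝ (Fin m) → ℝ}

/-- Every open set here is the support of a smooth function on the whole space; such a function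
vanishes on the frontier because `Ω` is open. -/
theorem exists_isBoundaryFactor (hΩ : IsOpen Ω) : ∃ d, IsBoundaryFactor Ω d := by
  obtain ⟨d, hd, hsm, -⟩ := hΩ.exists_contDiff_support_eq (n := 2)
  refine ⟨d, memCk_of_contDiff (by exact_mod_cast hsm), fun x hx => ?_, fun x hx => ?_⟩
  · rw [hΩ.frontier_eq, ← hd] at hx
    exact Function.notMem_support.1 hx.2
  · rw [← hd] at hx
    exact hx

namespace IsBoundaryFactor

theorem isBoundedC1_ansatz (hΩ : IsOpen Ω) (hb : Bornology.IsBounded Ω)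
    (hd : IsBoundaryFactor Ω d) (hg : MemCk 2 Ω g) (N : Network m 1) :
    IsBoundedC1 Ω (ansatz d N g) :=
  ((hd.memCk.isBoundedC1 hb one_le_two).mul hΩ
    (isBoundedC1_of_contDiff hb N.contDiff_eval_euclidean)).add hΩ (hg.isBoundedC1 hb one_le_two)

theorem contDiffOn_ansatz (hd : IsBoundaryFactor Ω d) (hg : MemCk 2 Ω g) (N : Network m 1) :
    ContDiffOn ℝ 2 (ansatz d N g) Ω :=
  (hd.memCk.contDiffOn.mul N.contDiff_eval_euclidean.contDiffOn).add hg.contDiffOn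

theorem memH10_ansatz_sub (hΩ : IsOpen Ω) (hb : Bornology.IsBounded Ω)
    (hd : IsBoundaryFactor Ω d) (N : Network m 1) : MemH10 Ω (ansatz d N g - g) := by
  have h : ansatz d N g - g = fun x => d x * N.eval (fun i => x i) 0 := by
    ext x
    simp [ansatz]
  rw [h]
  exact memH10_mul hΩ hb hd.memCk.continuousOn hd.eq_zero hd.ne_zero
    (hd.memCk.isBoundedC1 hb one_le_two) (isBoundedC1_of_contDiff hb N.contDiff_eval_euclidean)

end IsBoundaryFactor

end PoissonNN

end

/-! ### Well-posedness and stability with respect to the loss -/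

theorem mainTheorem1 (m : ℕ) (hm : 0 < m) (lam : NNReal) (hlam0 : 0 < lam) (hlam1 : lam < 1)
    (Ω : Set (EuclideanSpace ℝ (Fin m))) (hΩ_open : IsOpen Ω) (hΩ_bdd : Bornology.IsBounded Ω)
    (hΩ_bdry : PoissonNN.HasHolderBoundary 2 lam Ω)
    (g f : EuclideanSpace ℝ (Fin m) → ℝ)
    (hg : PoissonNN.MemHolder 2 lam Ω g) (hf : PoissonNN.MemHolder 0 lam Ω f) :
    ∃ uhat : EuclideanSpace ℝ (Fin m) → ℝ,
      PoissonNN.IsPoissonSolution Ω f g uhat ∧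
      (∀ v : EuclideanSpace ℝ (Fin m) → ℝ, PoissonNN.IsPoissonSolution Ω f g v →
        v =ᵐ[volume.restrict Ω] uhat) ∧
      (∃ d : EuclideanSpace ℝ (Fin m) → ℝ, PoissonNN.IsBoundaryFactor Ω d) ∧
      (∀ d : EuclideanSpace ℝ (Fin m) → ℝ, PoissonNN.IsBoundaryFactor Ω d →
        ∀ N : PoissonNN.Network m 1, PoissonNN.MemH1 Ω (PoissonNN.ansatz d N g)) ∧
      ∀ p : ENNReal, 2 ≤ p → ∀ ε : ℝ, 0 < ε → ∃ δ : ℝ, 0 < δ ∧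
        ∀ d : EuclideanSpace ℝ (Fin m) → ℝ, PoissonNN.IsBoundaryFactor Ω d →
        ∀ N : PoissonNN.Network m 1,
          PoissonNN.generalizedLoss Ω f p (PoissonNN.ansatz d N g) < ENNReal.ofReal δ →
          PoissonNN.h1Norm Ω (PoissonNN.ansatz d N g - uhat) < ε := by
  -- Positive dimension makes the space nontrivial, which supplies the unit vector in Poincaré's
  -- inequality.
  have : Nonempty (Fin m) := ⟨⟨0, hm⟩⟩
  have hgH := (hg.memCk.isBoundedC1 hΩ_bdd one_le_two).memH1 hΩ_open hΩ_bdd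
  have hfc : ContinuousOn f Ω := hf.memCk.continuousOn.mono subset_closure
  have hfL : MemLp f 2 (volume.restrict Ω) := by
    obtain ⟨C, hC⟩ := hΩ_bdd.isCompact_closure.exists_bound_of_continuousOn hf.memCk.continuousOn
    exact PoissonNN.memLp_of_continuousOn_of_bound hΩ_open hΩ_bdd hfc
      (fun x hx => hC x (subset_closure hx)) 2
  obtain ⟨uhat, hu⟩ := PoissonNN.exists_isPoissonSolution hΩ_open hΩ_bdd hfL hgH
  have hH1 : ∀ d, PoissonNN.IsBoundaryFactor Ω d → ∀ N : PoissonNN.Network m 1,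
      PoissonNN.MemH1 Ω (PoissonNN.ansatz d N g) := fun d hd N =>
    (hd.isBoundedC1_ansatz hΩ_open hΩ_bdd hg.memCk N).memH1 hΩ_open hΩ_bdd
  refine ⟨uhat, hu, fun v hv => hv.ae_eq hΩ_open hΩ_bdd hfL hgH hu,
    PoissonNN.exists_isBoundaryFactor hΩ_open, hH1, fun p hp ε hε => ?_⟩
  obtain ⟨R, hR⟩ := hΩ_bdd.exists_norm_le
  -- The stability constant times this bound is `ε / 2`, which leaves room for the strict
  -- inequality.
  have hη : 0 < ε / (2 * (4 * R ^ 2 + 1)) := by positivity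
  obtain ⟨δ, hδ, h⟩ :=
    PoissonNN.exists_eLpNorm_two_le_of_generalizedLoss_lt hΩ_bdd hp hη
  refine ⟨δ, hδ, fun d hd N hloss => ?_⟩
  have hC2 := hd.contDiffOn_ansatz hg.memCk N
  have hrc : ContinuousOn (PoissonNN.poissonResidual f (PoissonNN.ansatz d N g)) Ω :=
    (PoissonNN.continuousOn_laplacian hΩ_open hC2).neg.sub hfc
  have hm := hrc.aestronglyMeasurable (μ := volume) hΩ_open.measurableSet
  have hle := h f _ hm hloss
  have hr : MemLp (PoissonNN.poissonResidual f (PoissonNN.ansatz d N g)) 2 (volume.restrict Ω) :=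
    ⟨hm, hle.trans_lt ENNReal.ofReal_lt_top⟩
  refine (hu.h1Norm_sub_le hΩ_open hR hfL hgH hC2
    ((hd.isBoundedC1_ansatz hΩ_open hΩ_bdd hg.memCk N).memLp_gradient hΩ_open hΩ_bdd)
    (hH1 d hd N) (hd.memH10_ansatz_sub hΩ_open hΩ_bdd N) hr).trans_lt ?_
  calc _ ≤ (4 * R ^ 2 + 1) * (ε / (2 * (4 * R ^ 2 + 1))) := by
        gcongr
        exact ENNReal.toReal_le_of_le_ofReal hη.le hle
    _ = ε / 2 := by field_simp
    _ < ε := half_lt_self hε
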